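/- Notation. Let $n\ge 1$ and let $(M^n,g)$ be a smooth Riemannian manifold with center $o$: the exponential map $\exp_o:T_oM\to M$ is a diffeomorphism. Identify $T_oM$ with $\mathbb R^n$ by a linear isometry and $M$ with $\mathbb R^n$ by $\exp_o$, so that $M-\{o\}=\mathbb S^{n-1}\times\mathbb R^+$ and $g=g_r+dr^2$, with $r$ the distance to $o$; $B_r$ is the open ball of radius $r$ around $o$, and "outside $B_r$" means on its complement. Let $\sigma_{\mathbb S^{n-1}}$ be the round metric. The spherical cut of $g$ at $r_0$ is $\hat g_{r_0}=g_{r_0}/\sinh^2 r_0$. Fix smooth functions $\rho_W,\rho_T:\mathbb R\to[0,1]$ such that, for some $\delta>0$, $\rho_W=0$ on $(-\infty,\delta]$ and $\rho_W=1$ on $[\frac12-\delta,\infty)$, while $\rho_T=0$ on $(-\infty,0]$ and $\rho_T=1$ on $[1,\infty)$. Put $$\mathcal W_{r_0}g=(1-\rho_W(r-r_0))\big(\sinh^2(r)\,\hat g_{r_0}+dr^2\big)+\rho_W(r-r_0)\,g,$$ and, for $a,d>0$ and a metric $g'$ on $M-\{o\}$, $$\mathcal T_{a,d}\,g'=\Big(1-\rho_T\big(\tfrac{2(r-a)}d\big)\Big)\big(\sinh^2(r)\,\sigma_{\mathbb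 S^{n-1}}+dr^2\big)+\rho_T\big(\tfrac{2(r-a)}d\big)\,g'.$$ The hyperbolic forced metric is $\mathcal H_{r_0,d}\,g=\mathcal T_{r_0-d,d}(\mathcal W_{r_0}g)$, a metric on $M-\{o\}$. For $\xi>0$ let $\mathbb T_\xi=\mathbb B^{n-1}\times(-(1+\xi),1+\xi)$, with $\mathbb B^{n-1}$ the open unit ball of $\mathbb R^{n-1}$, and $\sigma=e^{2t}\sigma_{\mathbb R^{n-1}}+dt^2$. A metric $h$ on $M-\{o\}$ is radially $\epsilon$-close to hyperbolic on a set $S\subset M$, with charts of excess $\xi$, if for every $p\in S$ there is a chart $\phi:\mathbb T_\xi\to M-\{o\}=\mathbb S^{n-1}\times\mathbb R^+$ of the form $\phi(x,t)=(\phi_1(x),t+a)$, with $a$ constant, such that $\phi(0,0)=p$ and $|\phi^*h-\sigma|_{C^2}<\epsilon$ (uniform $C^2$-norm on $\mathbb T_\xi$ of the matrix of components in the canonical basis). It is $(B_a,\epsilon)$-close to hyperbolic, with charts of excess $\xi$, if $h=\sinh^2(r)\sigma_{\mathbb S^{n-1}}+dr^2$ on $B_a-\{o\}$ and $h$ is radially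 $\epsilon$-close to hyperbolic outside $B_{a-1-\xi}$, with charts of excess $\xi$. Fix a finite smooth atlas of $\mathbb S^{n-1}$ whose charts extend to neighbourhoods of the compact closures of their domains. For $c>1$, a metric on $\mathbb S^{n-1}$ is $c$-bounded if in each chart of the atlas the $C^2$-norms of its components are less than $c$ and the absolute value of the determinant of its matrix is greater than $1/c$ at every point. **Theorem 1.** Let $\xi>1$ and $c>1$. There are constants $C_2$, depending only on $\xi$ (and on the fixed function $\rho_W$), and $C_1$, depending only on $n,\xi,c$ (and on the fixed functions $\rho_W,\rho_T$ and atlas), with the following property. Let $(M^n,g)$ have center $o$ and let $r_0,d,\epsilon,\eta$ be real numbers with $d\ge 4(1+\xi)$ and $r_0-d\ge 2\xi$. If $\hat g_{r_0}$ is $c$-bounded, $g$ is radially $\epsilon$-close to hyperbolic outside $B_{r_0-(1+\xi)}$ with charts of excess $\xi$, and $$\eta\ \ge\ C_1\Big(\frac1d+e^{-(r_0-d)}\Big)+C_2\,\epsilon,$$ then $\mathcal H_{r_0,d}\,g$ is $(B_{r_0-d},\eta)$-close to hyperbolic, with charts of excess $\xi-1$. Moreover, if $|\rho_W'|\le 10^4$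 and $|\rho_W''|\le 10^4$ everywhere, then one can take $C_2=e^{16+6\xi}$. -/

import Mathlib

open scoped Manifold ContDiff ENNReal

universe u

/-- Euclidean space `ℝ^k`. -/
abbrev Euc (k : ℕ) : Type := EuclideanSpace ℝ (Fin k)

/-- A field of `2`-tensors on (a subset of) `ℝ^k`: the value `Q y v w` is the tensor at the point `y`
evaluated on the tangent vectors `v, w`. It is used for metrics on `ℝ^k - {0}` and, looking only at
unit vectors `y` and at `v, w` orthogonal to `y`, for metrics on the unit sphere of `ℝ^k`. -/
abbrev TensorField (k : ℕ) : Type := Euc k → Euc k → Euc k → ℝ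

/-- The uniform `C²`-norm on the open set `U` of a real function (`∞` if it is not bounded). -/
noncomputable def c2Norm {E : Type*} [NormedAddCommGroup E] [NormedSpace ℝ E]
    (U : Set E) (f : E → ℝ) : ℝ≥0∞ :=
  ⨆ k : Fin 3, ⨆ z ∈ U, ‖iteratedFDeriv ℝ (k : ℕ) f z‖ₑ

/-! ### The hyperbolic models and close to hyperbolic charts -/

/-- The ambient space `ℝ^m × ℝ` of the model of dimension `m + 1`. -/
abbrev ModelSpace (m : ℕ) : Type := Euc m × ℝ

/-- The model `𝕋_ξ = 𝔹 × (-(1+ξ), 1+ξ)`, where `𝔹` is the open unit ball of `ℝ^m`. -/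
def modelSet (m : ℕ) (ξ : ℝ) : Set (ModelSpace m) :=
  Metric.ball (0 : Euc m) 1 ×ˢ Set.Ioo (-(1 + ξ)) (1 + ξ)

/-- The canonical basis vectors of `ℝ^m × ℝ`. -/
noncomputable def modelBasis (m : ℕ) : Fin m ⊕ Unit → ModelSpace m
  | Sum.inl i => (EuclideanSpace.single i 1, 0)
  | Sum.inr _ => (0, 1)

/-- The hyperbolic metric `σ = e^{2t} σ_{ℝ^m} + dt²` of the model. -/
noncomputable def modelMetric (m : ℕ) (z v w : ModelSpace m) : ℝ :=
  Real.exp (2 * z.2) * inner ℝ v.1 w.1 + v.2 * w.2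

/-- The pull-back `φ^* Q`. -/
noncomputable def pullbackModel {m : ℕ} (φ : ModelSpace m → Euc (m + 1))
    (Q : TensorField (m + 1)) (z v w : ModelSpace m) : ℝ :=
  Q (φ z) (fderiv ℝ φ z v) (fderiv ℝ φ z w)

/-- The tensor `q` on `𝕋_ξ` satisfies `|q - σ|_{C²} < ε`, where a tensor is viewed as the matrix
function of its components in the canonical basis. -/
def EpsCloseToModel {m : ℕ} (ξ ε : ℝ) (q : ModelSpace m → ModelSpace m → ModelSpace m → ℝ) :
    Prop :=
  ∀ i j : Fin m ⊕ Unit,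
    c2Norm (modelSet m ξ)
      (fun z => q z (modelBasis m i) (modelBasis m j)
        - modelMetric m z (modelBasis m i) (modelBasis m j)) < ENNReal.ofReal ε

/-- `φ` is a chart `𝕋_ξ → ℝ^{m+1} - {0} = 𝕊^m × ℝ⁺` (a smooth injective immersion between manifolds of
the same dimension, so a diffeomorphism onto an open set) that respects the product structures:
`φ(x,t) = (φ₁(x), t + a)`, the pair `(u, r)` being the point `r • u`. -/
structure IsRadialChart {m : ℕ} (ξ : ℝ) (φ : ModelSpace m → Euc (m + 1)) : Prop where
  smooth : ContDiffOn ℝ ∞ φ (modelSet m ξ)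
  injOn : Set.InjOn φ (modelSet m ξ)
  immersion : ∀ z ∈ modelSet m ξ, Function.Injective (fderiv ℝ φ z)
  radial : ∃ (φ₁ : Euc m → Euc (m + 1)) (a : ℝ), ∀ z ∈ modelSet m ξ,
    ‖φ₁ z.1‖ = 1 ∧ 0 < z.2 + a ∧ φ z = (z.2 + a) • φ₁ z.1

/-- The metric `Q` on `ℝ^{m+1} - {0}` is radially `ε`-close to hyperbolic on the set `S`, with charts
of excess `ξ`. -/
def RadiallyClose {m : ℕ} (Q : TensorField (m + 1)) (ε ξ : ℝ) (S : Set (Euc (m + 1))) : Prop :=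
  ∀ p ∈ S, ∃ φ : ModelSpace m → Euc (m + 1),
    IsRadialChart ξ φ ∧ φ (0, 0) = p ∧ EpsCloseToModel ξ ε (pullbackModel φ Q)

/-! ### Metrics in polar coordinates -/

/-- The component of `v` orthogonal to the unit vector `u`. -/
noncomputable def tangPart {k : ℕ} (u v : Euc k) : Euc k := v - (inner ℝ u v : ℝ) • u

/-- The metric `h_r + dr²` on `ℝ^k - {0} = 𝕊^{k-1} × ℝ⁺`. At `y = r u`, with `r = ‖y‖`, the vector `v`
corresponds to the pair (`r⁻¹` times its part orthogonal to `u`, `⟨u, v⟩`). -/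
noncomputable def polarMetric {k : ℕ} (h : ℝ → TensorField k) : TensorField k := fun y v w =>
  h ‖y‖ (‖y‖⁻¹ • y) (‖y‖⁻¹ • tangPart (‖y‖⁻¹ • y) v) (‖y‖⁻¹ • tangPart (‖y‖⁻¹ • y) w)
    + (inner ℝ (‖y‖⁻¹ • y) v : ℝ) * (inner ℝ (‖y‖⁻¹ • y) w : ℝ)

/-- The round metric of the unit sphere. -/
noncomputable def roundMetric (k : ℕ) : TensorField k := fun _ v w => inner ℝ v w

/-- The warped metric `sinh²(r) h + dr²`. -/
noncomputable def sinhWarped {k : ℕ} (h : TensorField k) : TensorField k :=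
  polarMetric (fun r => Real.sinh r ^ 2 • h)

/-- The hyperbolic metric `sinh²(r) σ_𝕊 + dr²`. -/
noncomputable def hypMetric (k : ℕ) : TensorField k := sinhWarped (roundMetric k)

/-- The (warped) spherical cut `g_r`: the restriction of `G` to the sphere of radius `r`, seen on the
unit sphere through `u ↦ r u`. -/
def warpedCut {k : ℕ} (G : TensorField k) (r : ℝ) : TensorField k :=
  fun u v w => G (r • u) (r • v) (r • w)

/-- The (unwarped) spherical cut `ĝ_r = g_r / sinh²(r)`. -/
noncomputable def sphericalCut {k : ℕ} (G : TensorField k) (r : ℝ) : TensorField k :=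
  (1 / Real.sinh r ^ 2) • warpedCut G r

/-! ### Warp forcing, the two variable warping trick, hyperbolic forcing -/

/-- Gluing functions for warp forcing. -/
structure IsWarpForcingCutoff (ρ : ℝ → ℝ) : Prop where
  smooth : ContDiff ℝ ∞ ρ
  mem_Icc : ∀ t, ρ t ∈ Set.Icc (0 : ℝ) 1
  plateaus : ∃ δ > 0, (∀ t ≤ δ, ρ t = 0) ∧ ∀ t, 1 / 2 - δ ≤ t → ρ t = 1

/-- Gluing functions for the two variable warping trick. -/
structure IsWarpTrickCutoff (ρ : ℝ → ℝ) : Prop where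
  smooth : ContDiff ℝ ∞ ρ
  mem_Icc : ∀ t, ρ t ∈ Set.Icc (0 : ℝ) 1
  eq_zero : ∀ t ≤ 0, ρ t = 0
  eq_one : ∀ t, 1 ≤ t → ρ t = 1

/-- Warp forcing: `𝒲_{r₀} g = (1 - ρ(r - r₀)) (sinh²(r) ĝ_{r₀} + dr²) + ρ(r - r₀) g`. -/
noncomputable def warpForce {k : ℕ} (ρ : ℝ → ℝ) (r₀ : ℝ) (G : TensorField k) : TensorField k :=
  fun y v w => (1 - ρ (‖y‖ - r₀)) * sinhWarped (sphericalCut G r₀) y v w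
    + ρ (‖y‖ - r₀) * G y v w

/-- The two variable warping trick `𝒯_{a,d}`, written so that it applies to any metric. Where `G` is
warped it is the usual formula, by `warpTrick_sinhWarped`; outside the ball of radius `a + d/2` it
does not change `G`. -/
noncomputable def warpTrick {k : ℕ} (ρ : ℝ → ℝ) (a d : ℝ) (G : TensorField k) : TensorField k :=
  fun y v w => (1 - ρ (2 * ((‖y‖ - a) / d))) * hypMetric k y v w
    + ρ (2 * ((‖y‖ - a) / d)) * G y v w

/-- `𝒯_{a,d}(sinh²(r) h + dr²) = sinh²(r) ((1 - ρ_{a,d}(r)) σ_𝕊 + ρ_{a,d}(r) h) + dr²`,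
where `ρ_{a,d}(r) = ρ(2 (r - a) / d)`. -/
theorem warpTrick_sinhWarped {k : ℕ} (ρ : ℝ → ℝ) (a d : ℝ) (h : TensorField k) :
    warpTrick ρ a d (sinhWarped h) =
      polarMetric (fun r => Real.sinh r ^ 2 •
        ((1 - ρ (2 * ((r - a) / d))) • roundMetric k + ρ (2 * ((r - a) / d)) • h)) := by
  funext y v w
  simp only [warpTrick, hypMetric, sinhWarped, polarMetric, Pi.smul_apply, Pi.add_apply,
    smul_eq_mul]
  ring

/-- Hyperbolic forcing `ℋ_{r₀,d} = 𝒯_{r₀-d,d} ∘ 𝒲_{r₀}`; `ρT` and `ρW` are the gluing functions of the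
two constructions. -/
noncomputable def hypForce {k : ℕ} (ρT ρW : ℝ → ℝ) (r₀ d : ℝ) (G : TensorField k) :
    TensorField k :=
  warpTrick ρT (r₀ - d) d (warpForce ρW r₀ G)

/-- The metric `Q` on `ℝ^{m+1} - {0}` is `(B_a, ε)`-close to hyperbolic, with charts of excess `ξ`. -/
def BallCloseToHyperbolic {m : ℕ} (Q : TensorField (m + 1)) (a ε ξ : ℝ) : Prop :=
  (∀ y : Euc (m + 1), y ≠ 0 → ‖y‖ < a → ∀ v w, Q y v w = hypMetric (m + 1) y v w) ∧
    RadiallyClose Q ε ξ (Metric.ball 0 (a - 1 - ξ))ᶜ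

/-! ### Bounded metrics on the sphere -/

/-- A finite atlas of the unit sphere of `ℝ^{m+1}`, given by parametrizations
`param i : U i → 𝕊^m`, each of which extends to a neighbourhood `W i` of the compact closure
of `U i`. -/
structure SphereAtlas (m : ℕ) where
  card : ℕ
  U : Fin card → Set (Euc m)
  W : Fin card → Set (Euc m)
  param : Fin card → Euc m → Euc (m + 1)
  isOpen_U : ∀ i, IsOpen (U i)
  isOpen_W : ∀ i, IsOpen (W i)
  isCompact_closure : ∀ i, IsCompact (closure (U i))
  closure_subset : ∀ i, closure (U i) ⊆ W i
  smooth : ∀ i, ContDiffOn ℝ ∞ (param i) (W i)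
  injOn : ∀ i, Set.InjOn (param i) (W i)
  immersion : ∀ i, ∀ x ∈ W i, Function.Injective (fderiv ℝ (param i) x)
  norm_param : ∀ i, ∀ x ∈ W i, ‖param i x‖ = 1
  covers : ∀ u : Euc (m + 1), ‖u‖ = 1 → ∃ i, u ∈ param i '' U i

/-- The matrix of the metric `k` on the sphere in a chart of the atlas. -/
noncomputable def SphereAtlas.matrix {m : ℕ} (𝒜 : SphereAtlas m) (k : TensorField (m + 1))
    (i : Fin 𝒜.card) (x : Euc m) : Matrix (Fin m) (Fin m) ℝ :=
  Matrix.of fun p q => k (𝒜.param i x) (fderiv ℝ (𝒜.param i) x (EuclideanSpace.single p 1))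
    (fderiv ℝ (𝒜.param i) x (EuclideanSpace.single q 1))

/-- `k` is `c`-bounded: `|k|_{C²} < c` and `|det k| > 1/c` in the charts of the atlas. -/
def CBounded {m : ℕ} (𝒜 : SphereAtlas m) (c : ℝ) (k : TensorField (m + 1)) : Prop :=
  ∀ i, (∀ p q, c2Norm (𝒜.U i) (fun x => 𝒜.matrix k i x p q) < ENNReal.ofReal c) ∧
    ∀ x ∈ 𝒜.U i, 1 / c < |(𝒜.matrix k i x).det|

/-! ### Manifolds with center -/

/-- `γ` is a geodesic of the metric `G` on `ℝ^k`: it solves the Euler-Lagrange equation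
`d/ds G_γ(γ', w) = ½ (D_w G)_γ(γ', γ')` of the energy. -/
def IsGeodesicCurve {k : ℕ} (G : TensorField k) (γ : ℝ → Euc k) : Prop :=
  ContDiff ℝ ∞ γ ∧ ∀ (s : ℝ) (w : Euc k),
    HasDerivAt (fun τ => G (γ τ) (deriv γ τ) w)
      (1 / 2 * fderiv ℝ (fun y => G y (deriv γ s) (deriv γ s)) (γ s) w) s

section Center

variable {k : ℕ} {M : Type*} [TopologicalSpace M] [ChartedSpace (Euc k) M]
  [IsManifold (𝓡 k) ∞ M]

/-- The pull-back of the Riemannian metric `g` by a diffeomorphism `Φ : ℝ^k → M`. -/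
noncomputable def pullbackMetric
    (g : Bundle.ContMDiffRiemannianMetric (𝓡 k) ∞ (Euc k)
      (fun x : M => TangentSpace (𝓡 k) x))
    (Φ : Diffeomorph (𝓡 k) (𝓡 k) (Euc k) M ∞) : TensorField k :=
  fun y v w => g.inner (Φ y) (mfderiv (𝓡 k) (𝓡 k) Φ y v) (mfderiv (𝓡 k) (𝓡 k) Φ y w)

/-- `(M, g)` has center `o`, and the diffeomorphism `Φ : ℝ^k → M` is the exponential map at `o`, where
`T_oM` is identified with `ℝ^k` by the linear isometry `dΦ₀`: the rays `s ↦ s v` are sent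
to the geodesics with initial point `o` and initial velocity `dΦ₀ v`. (That a curve in `M` is
a geodesic is expressed in the global chart `Φ⁻¹`.) -/
structure IsExpAtCenter
    (g : Bundle.ContMDiffRiemannianMetric (𝓡 k) ∞ (Euc k)
      (fun x : M => TangentSpace (𝓡 k) x))
    (o : M) (Φ : Diffeomorph (𝓡 k) (𝓡 k) (Euc k) M ∞) : Prop where
  map_zero : Φ 0 = o
  isometry_zero : ∀ v w : Euc k, pullbackMetric g Φ 0 v w = inner ℝ v w
  geodesic : ∀ v : Euc k, IsGeodesicCurve (pullbackMetric g Φ) (fun s => s • v)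

end Center

/-! In the global chart given by the exponential map, the Gauss lemma says that the metric is `g_r +
dr²`. All metrics being interpolated share the term `dr²` and the weights add up to one, so forcing
acts on the spherical part alone: it produces `forcedCut + dr²`. In a chart `(x,t) ↦ (t+a) φ₁(x)`
the pull-back then involves only `φ₁` and its derivative. The points to be covered split along the
sphere of radius `r₀ - ξ`.

Outside it (`c2BoundedOn_hypForce_of_epsClose`) the given chart is kept, with its excess lowered by
one. There the trick cutoff is already 1, and only the replacement of `g_r` by `sinh²(r) ĝ_{r₀}`
near `r = r₀` has to be controlled. The slice `r = r₀` lies in the larger chart, so its metric is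
`e^{2(r₀-a)}` times the flat one up to `ε`. The rescaling `sinh²(t+a)/sinh²(r₀)` turns this into
`e^{2t}` up to `e^{-(r₀-d)}`. This is the source of `C₂ε`, with `C₂` depending on `ξ` and bounds for
the derivatives of `ρW` only.

Inside it (`exists_chart_hypForce`) the metric is `sinh²(r)((1-ρ)σ_𝕊 + ρ ĝ_{r₀}) + dr²` with `ρ` a
function of `2(r-(r₀-d))/d`, and a chart is built by hand: a chart of the atlas precomposed with `x
↦ x₀ + 2e^{-a} T x`, where `T` makes the interpolated metric at the center Euclidean. The factor
`4e^{-2a} sinh²(t+a)` is close to `e^{2t}`; the interpolated metric varies at rate `e^{-a}` in `x`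
and `1/d` in `t`, hence is nearly constant in `C²`. Uniformity of `T` comes from compactness:
`c`-boundedness gives a common lower bound for all interpolated forms
(`exists_interpMatrix_lower_bound`). If `a` is too small for the chart to fit in the atlas, then
`e^{-(r₀-d)}` is bounded below and a crude estimate suffices. -/

/-! ### Calculus of `C²` bounds on open sets. -/

section C2

variable {E F : Type*} [NormedAddCommGroup E] [NormedSpace ℝ E]
  [NormedAddCommGroup F] [NormedSpace ℝ F]

/-- `f` is `C²` on `U`, with derivatives of order at most `2` bounded by `K`. -/
structure C2BoundedOn (U : Set E) (f : E → ℝ) (K : ℝ) : Prop where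
  contDiffOn : ContDiffOn ℝ 2 f U
  bound : ∀ k : ℕ, k ≤ 2 → ∀ z ∈ U, ‖iteratedFDeriv ℝ k f z‖ ≤ K

namespace C2BoundedOn

variable {U V : Set E} {f g : E → ℝ} {K K' : ℝ}

theorem mono (h : C2BoundedOn U f K) (hK : K ≤ K') : C2BoundedOn U f K' :=
  ⟨h.1, fun k hk z hz => (h.2 k hk z hz).trans hK⟩

theorem mono_set (h : C2BoundedOn U f K) (hV : V ⊆ U) : C2BoundedOn V f K :=
  ⟨h.1.mono hV, fun k hk z hz => h.2 k hk z (hV hz)⟩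

theorem congr (hU : IsOpen U) (h : C2BoundedOn U f K) (hfg : ∀ z ∈ U, g z = f z) :
    C2BoundedOn U g K := by
  refine ⟨h.1.congr hfg, fun k hk z hz => ?_⟩
  have : g =ᶠ[nhds z] f := Filter.eventuallyEq_of_mem (hU.mem_nhds hz) hfg
  rw [(this.iteratedFDeriv ℝ k).eq_of_nhds]
  exact h.2 k hk z hz

theorem abs_le (h : C2BoundedOn U f K) {z : E} (hz : z ∈ U) : |f z| ≤ K := by
  simpa using h.2 0 (by norm_num) z hz

theorem of_c2Norm_lt (hf : ContDiffOn ℝ 2 f U) (h : c2Norm U f < ENNReal.ofReal K) :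
    C2BoundedOn U f K := by
  refine ⟨hf, fun k hk z hz => ?_⟩
  have h1 : ‖iteratedFDeriv ℝ k f z‖ₑ ≤ c2Norm U f :=
    le_iSup_of_le (⟨k, by omega⟩ : Fin 3) (le_iSup₂_of_le z hz le_rfl)
  have h2 : ‖iteratedFDeriv ℝ k f z‖ₑ < ENNReal.ofReal K := h1.trans_lt h
  rw [← ofReal_norm] at h2
  exact (ENNReal.ofReal_lt_ofReal_iff'.1 h2).1.le

theorem c2Norm_lt (h : C2BoundedOn U f K) (hK : K < K') (hK' : 0 < K') :
    c2Norm U f < ENNReal.ofReal K' := by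
  refine lt_of_le_of_lt ?_ ((ENNReal.ofReal_lt_ofReal_iff hK').2 hK)
  refine iSup_le fun k => iSup₂_le fun z hz => ?_
  rw [← ofReal_norm]
  exact ENNReal.ofReal_le_ofReal (h.2 k (by omega) z hz)

theorem const (U : Set E) (a : ℝ) : C2BoundedOn U (fun _ => a) |a| := by
  refine ⟨contDiffOn_const, fun k hk z hz => ?_⟩
  rcases k with _ | k
  · simp
  · simp [iteratedFDeriv_const_of_ne (𝕜 := ℝ) (Nat.succ_ne_zero k) a]

theorem add (hU : IsOpen U) (hf : C2BoundedOn U f K) (hg : C2BoundedOn U g K') :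
    C2BoundedOn U (fun z => f z + g z) (K + K') := by
  refine ⟨hf.1.add hg.1, fun k hk z hz => ?_⟩
  have hk' : (k : ℕ∞ω) ≤ 2 := by exact_mod_cast hk
  have h1 := ((hf.1.contDiffAt (hU.mem_nhds hz)).of_le hk')
  have h2 := ((hg.1.contDiffAt (hU.mem_nhds hz)).of_le hk')
  rw [fun_iteratedFDeriv_add_apply h1 h2]
  exact (norm_add_le _ _).trans (add_le_add (hf.2 k hk z hz) (hg.2 k hk z hz))

theorem mul (hU : IsOpen U) (hf : C2BoundedOn U f K) (hg : C2BoundedOn U g K') :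
    C2BoundedOn U (fun z => f z * g z) (4 * K * K') := by
  refine ⟨hf.1.mul hg.1, fun k hk z hz => ?_⟩
  have hk' : (k : ℕ∞ω) ≤ 2 := by exact_mod_cast hk
  have h := norm_iteratedFDerivWithin_mul_le (𝕜 := ℝ) hf.1 hg.1 hU.uniqueDiffOn hz hk'
  simp only [iteratedFDerivWithin_of_isOpen _ hU hz] at h
  refine h.trans ?_
  have hK : 0 ≤ K := (norm_nonneg _).trans (hf.2 0 (by norm_num) z hz)
  have hK' : 0 ≤ K' := (norm_nonneg _).trans (hg.2 0 (by norm_num) z hz)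
  have h3 : ∀ i ∈ Finset.range (k + 1), (k.choose i : ℝ) * ‖iteratedFDeriv ℝ i f z‖ *
      ‖iteratedFDeriv ℝ (k - i) g z‖ ≤ (k.choose i : ℝ) * K * K' := by
    intro i hi
    have : i ≤ k := by simpa [Nat.lt_succ_iff] using hi
    have h1 := hf.2 i (by omega) z hz
    have h2 := hg.2 (k - i) (by omega) z hz
    gcongr
  refine (Finset.sum_le_sum h3).trans ?_
  rw [← Finset.sum_mul, ← Finset.sum_mul]
  -- The factor 4 of the product rule is the sum `2 ^ k` of the binomial coefficients at the top
  -- order `k = 2`.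
  have h4 : (∑ i ∈ Finset.range (k + 1), (k.choose i : ℝ)) ≤ 4 := by
    have := Nat.sum_range_choose k
    rw [← Nat.cast_sum, this]
    have : 2 ^ k ≤ 2 ^ 2 := Nat.pow_le_pow_right (by norm_num) hk
    exact_mod_cast this
  gcongr

theorem const_mul (hU : IsOpen U) (a : ℝ) (hf : C2BoundedOn U f K) :
    C2BoundedOn U (fun z => a * f z) (|a| * K) := by
  refine ⟨contDiffOn_const.mul hf.1, fun k hk z hz => ?_⟩
  have hk' : (k : ℕ∞ω) ≤ 2 := by exact_mod_cast hk
  have h1 := ((hf.1.contDiffAt (hU.mem_nhds hz)).of_le hk')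
  have := iteratedFDeriv_const_smul_apply' (𝕜 := ℝ) (a := a) h1
  simp only [smul_eq_mul] at this
  rw [this, norm_smul]
  exact mul_le_mul_of_nonneg_left (hf.2 k hk z hz) (abs_nonneg a)

theorem sub (hU : IsOpen U) (hf : C2BoundedOn U f K) (hg : C2BoundedOn U g K') :
    C2BoundedOn U (fun z => f z - g z) (K + K') := by
  have := (hf.add hU (hg.const_mul hU (-1)))
  simp only [abs_neg, abs_one, one_mul, neg_mul] at this
  simpa [sub_eq_add_neg] using this

theorem sum (hU : IsOpen U) {ι : Type*} (s : Finset ι) {f : ι → E → ℝ} {K : ι → ℝ}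
    (h : ∀ i ∈ s, C2BoundedOn U (f i) (K i)) :
    C2BoundedOn U (fun z => ∑ i ∈ s, f i z) (∑ i ∈ s, K i) := by
  classical
  induction s using Finset.induction_on with
  | empty => simpa using const U 0
  | insert a s ha ih =>
    simp only [Finset.sum_insert ha]
    exact (h a (by simp)).add hU (ih fun i hi => h i (by simp [hi]))

/-- An affine map has no second derivative, so the chain rule has a single term and the order `k`
derivative gains exactly `‖T‖ ^ k`. Keeping the power is what makes slow variation small in `C²`. -/
theorem norm_iteratedFDeriv_comp_affine_le {V : Set F} {f : F → ℝ} (hV : IsOpen V)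
    (hf : C2BoundedOn V f K) (T : E →L[ℝ] F) (c : F) {k : ℕ} (hk : k ≤ 2) {z : E}
    (hz : c + T z ∈ V) :
    ‖iteratedFDeriv ℝ k (fun z => f (c + T z)) z‖ ≤ K * ‖T‖ ^ k := by
  have hk' : (k : ℕ∞ω) ≤ 2 := by exact_mod_cast hk
  set V' : Set F := (fun y => c + y) ⁻¹' V with hV'
  have hV'o : IsOpen V' := hV.preimage (by fun_prop)
  have hf' : ContDiffOn ℝ 2 (fun y => f (c + y)) V' :=
    hf.1.comp (by fun_prop) (fun y hy => hy)
  have h := T.iteratedFDerivWithin_comp_right hf' hV'o.uniqueDiffOn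
    (hV'o.preimage T.continuous).uniqueDiffOn (x := z) hz hk'
  rw [iteratedFDerivWithin_of_isOpen _ (hV'o.preimage T.continuous) hz,
    iteratedFDerivWithin_of_isOpen _ hV'o hz, iteratedFDeriv_comp_add_left] at h
  change ‖iteratedFDeriv ℝ k ((fun y => f (c + y)) ∘ T) z‖ ≤ _
  rw [h]
  refine (ContinuousMultilinearMap.norm_compContinuousLinearMap_le _ _).trans ?_
  simp only [Finset.prod_const, Finset.card_univ, Fintype.card_fin]
  exact mul_le_mul_of_nonneg_right (hf.2 k hk _ hz) (by positivity)

theorem contDiffOn_comp_affine {V : Set F} {f : F → ℝ}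
    (hf : C2BoundedOn V f K) (T : E →L[ℝ] F) (c : F) (hUV : ∀ z ∈ U, c + T z ∈ V) :
    ContDiffOn ℝ 2 (fun z => f (c + T z)) U :=
  hf.1.comp (by fun_prop) hUV

theorem comp_affine {V : Set F} {f : F → ℝ} (hV : IsOpen V) (hf : C2BoundedOn V f K)
    (T : E →L[ℝ] F) (hT : ‖T‖ ≤ 1) (c : F) (hUV : ∀ z ∈ U, c + T z ∈ V) :
    C2BoundedOn U (fun z => f (c + T z)) K := by
  refine ⟨hf.contDiffOn_comp_affine T c hUV, fun k hk z hz => ?_⟩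
  have hK : 0 ≤ K := (norm_nonneg _).trans (hf.2 0 (by norm_num) _ (hUV z hz))
  refine (norm_iteratedFDeriv_comp_affine_le hV hf T c hk (hUV z hz)).trans ?_
  exact mul_le_of_le_one_right hK (pow_le_one₀ (norm_nonneg _) hT)

/-- Composition with an affine map whose linear part is small is nearly constant in `C²`. -/
theorem comp_affine_sub_const {V : Set F} {f : F → ℝ} (hV : IsOpen V) (hf : C2BoundedOn V f K)
    (T : E →L[ℝ] F) {κ R : ℝ} (hT : ‖T‖ ≤ κ) (hκ : κ ≤ 1) (hR : 1 ≤ R) (c : F)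
    (hU : IsOpen U) (hconv : Convex ℝ U) (h0 : (0 : E) ∈ U) (hUR : ∀ z ∈ U, ‖z‖ ≤ R)
    (hUV : ∀ z ∈ U, c + T z ∈ V) :
    C2BoundedOn U (fun z => f (c + T z) - f c) (K * κ * R) := by
  have hK : 0 ≤ K := (norm_nonneg _).trans (hf.2 0 (by norm_num) _ (hUV 0 h0))
  have hκ0 : 0 ≤ κ := (norm_nonneg _).trans hT
  have hsm := hf.contDiffOn_comp_affine T c hUV
  have hd : ∀ k, 1 ≤ k → k ≤ 2 → ∀ z ∈ U, ‖iteratedFDeriv ℝ k (fun z => f (c + T z)) z‖ ≤ K * κ := by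
    intro k hk1 hk z hz
    refine (norm_iteratedFDeriv_comp_affine_le hV hf T c hk (hUV z hz)).trans ?_
    refine mul_le_mul_of_nonneg_left ?_ hK
    calc ‖T‖ ^ k ≤ κ ^ k := by gcongr
      _ ≤ κ ^ 1 := pow_le_pow_of_le_one hκ0 hκ hk1
      _ = κ := pow_one κ
  refine ⟨hsm.sub contDiffOn_const, fun k hk z hz => ?_⟩
  -- Order zero is the mean value inequality along the segment from the origin, which costs the
  -- factor `R`. In positive order the constant disappears and one factor `κ` survives.
  rcases Nat.eq_zero_or_pos k with rfl | hk1
  · rw [norm_iteratedFDeriv_zero]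
    have h1 : ∀ x ∈ U, ‖fderiv ℝ (fun z => f (c + T z)) x‖ ≤ K * κ := by
      intro x hx
      rw [← norm_iteratedFDeriv_one]
      exact hd 1 le_rfl (by norm_num) x hx
    have h2 := hconv.norm_image_sub_le_of_norm_fderiv_le (𝕜 := ℝ)
      (fun x hx => ((hsm.contDiffAt (hU.mem_nhds hx)).differentiableAt (by norm_num))) h1 h0 hz
    simp only [map_zero, add_zero, sub_zero] at h2
    exact h2.trans (mul_le_mul_of_nonneg_left (hUR z hz) (by positivity))
  · have hk' : (k : ℕ∞ω) ≤ 2 := by exact_mod_cast hk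
    have h1 := ((hsm.contDiffAt (hU.mem_nhds hz)).of_le hk')
    rw [fun_iteratedFDeriv_sub_apply h1 contDiffAt_const,
      iteratedFDeriv_const_of_ne (𝕜 := ℝ) hk1.ne', Pi.zero_apply, sub_zero]
    refine (hd k hk1 hk z hz).trans ?_
    exact le_mul_of_one_le_right (by positivity) hR

end C2BoundedOn

end C2

theorem c2BoundedOn_of_deriv_le {f : ℝ → ℝ} (hf : ContDiff ℝ ∞ f) {U : Set ℝ} {K : ℝ}
    (h0 : ∀ t ∈ U, |f t| ≤ K) (h1 : ∀ t ∈ U, |deriv f t| ≤ K)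
    (h2 : ∀ t ∈ U, |deriv (deriv f) t| ≤ K) :
    C2BoundedOn U f K := by
  refine ⟨(contDiff_infty.1 hf 2).contDiffOn, fun k hk z hz => ?_⟩
  rw [norm_iteratedFDeriv_eq_norm_iteratedDeriv]
  interval_cases k
  · simpa using h0 z hz
  · simpa [iteratedDeriv_one] using h1 z hz
  · simpa [iteratedDeriv_succ, iteratedDeriv_one] using h2 z hz

theorem c2BoundedOn_exp_two_mul {R : ℝ} :
    C2BoundedOn (Set.Iio R) (fun t => Real.exp (2 * t)) (4 * Real.exp (2 * R)) := by
  have hd : deriv (fun t : ℝ => Real.exp (2 * t)) = fun t => 2 * Real.exp (2 * t) := by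
    funext t
    have : HasDerivAt (fun t : ℝ => Real.exp (2 * t)) (Real.exp (2 * t) * (2 * 1)) t :=
      ((hasDerivAt_id t).const_mul 2).exp
    rw [this.deriv]; ring
  have hd2 : deriv (deriv (fun t : ℝ => Real.exp (2 * t))) = fun t => 4 * Real.exp (2 * t) := by
    rw [hd]
    funext t
    rw [deriv_const_mul _ (by fun_prop), hd]; ring
  have hb : ∀ t ∈ Set.Iio R, Real.exp (2 * t) ≤ Real.exp (2 * R) := fun t ht => by
    have : t < R := ht
    gcongr
  refine c2BoundedOn_of_deriv_le (by fun_prop) (fun t ht => ?_) (fun t ht => ?_) (fun t ht => ?_)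
  · rw [abs_of_nonneg (by positivity)]; linarith [hb t ht, Real.exp_pos (2 * R)]
  · rw [hd, abs_of_nonneg (by positivity)]; linarith [hb t ht, Real.exp_pos (2 * R)]
  · rw [hd2, abs_of_nonneg (by positivity)]; linarith [hb t ht, Real.exp_pos (2 * R)]

/-! ### The Gauss lemma and reduction from the manifold to `ℝ^k`. -/

/-- A smooth field of symmetric nonnegative bilinear forms on `ℝ^k` for which the rays from the
origin have unit speed and are orthogonal to the spheres around the origin. -/
structure IsRadialForm {k : ℕ} (G : Euc k → Euc k →L[ℝ] Euc k →L[ℝ] ℝ) : Prop where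
  smooth : ContDiff ℝ ∞ G
  symm : ∀ y v w, G y v w = G y w v
  nonneg : ∀ y v, 0 ≤ G y v v
  gauss : ∀ y w, G y y w = inner ℝ y w

/-- The Gauss lemma. -/
theorem gauss_lemma {k : ℕ} {G : Euc k → Euc k →L[ℝ] Euc k →L[ℝ] ℝ} (hG : ContDiff ℝ ∞ G)
    (hsymm : ∀ y v w, G y v w = G y w v) (h0 : ∀ v w, G 0 v w = inner ℝ v w)
    (hgeo : ∀ v : Euc k, IsGeodesicCurve (fun y v w => G y v w) (fun s : ℝ => s • v))
    (y w : Euc k) : G y y w = inner ℝ y w := by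
  have hdiff : ∀ v w : Euc k, Differentiable ℝ fun y => G y v w := fun v w =>
    ((hG.clm_apply contDiff_const).clm_apply contDiff_const).differentiable (by simp)
  have hder : ∀ v : Euc k, ∀ τ : ℝ, deriv (fun s : ℝ => s • v) τ = v := fun v τ => by
    simpa using ((hasDerivAt_id τ).smul_const v).deriv
  have hgeo' : ∀ (v w : Euc k) (s : ℝ), HasDerivAt (fun τ : ℝ => G (τ • v) v w)
      (1 / 2 * fderiv ℝ (fun y => G y v v) (s • v) w) s := fun v w s => by
    have := (hgeo v).2 s w
    simpa only [hder] using this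
  -- Rays have constant speed: tested on its own velocity, the geodesic equation equates the
  -- derivative of the energy along the ray with half of itself.
  have hE : ∀ v : Euc k, G v v v = inner ℝ v v := by
    intro v
    have h1 : ∀ s : ℝ, HasDerivAt (fun τ : ℝ => G (τ • v) v v) 0 s := by
      intro s
      have h2 := hgeo' v v s
      have h3 : HasDerivAt (fun τ : ℝ => G (τ • v) v v) (fderiv ℝ (fun y => G y v v) (s • v) v) s := by
        have h4 : HasDerivAt (fun τ : ℝ => τ • v) v s := by
          simpa using (hasDerivAt_id s).smul_const v
        exact ((hdiff v v) (s • v)).hasFDerivAt.comp_hasDerivAt s h4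
      have h5 := h2.unique h3
      have h6 : fderiv ℝ (fun y => G y v v) (s • v) v = 0 := by linarith
      rwa [h6] at h3
    have h7 := is_const_of_deriv_eq_zero (fun s => (h1 s).differentiableAt)
      (fun s => (h1 s).deriv) 1 0
    simpa [h0] using h7
  have hkey : ∀ s : ℝ, s ≠ 0 → s * (1 / 2 * fderiv ℝ (fun y => G y y y) (s • y) w) =
      s * (s * inner ℝ y w) := by
    intro s hs
    have : (fun y => G y y y) = fun y : Euc k => inner ℝ y y := funext hE
    rw [this]
    have h1 : HasFDerivAt (fun y : Euc k => inner ℝ y y)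
      ((fderivInnerCLM ℝ (s • y, s • y)).comp
        ((ContinuousLinearMap.id ℝ (Euc k)).prod (ContinuousLinearMap.id ℝ (Euc k)))) (s • y) :=
      (hasFDerivAt_id _).inner ℝ (hasFDerivAt_id _)
    rw [h1.fderiv]
    simp [inner_smul_left, inner_smul_right, real_inner_comm w y]
    ring_nf
    simp
  have hprod : ∀ z : Euc k, fderiv ℝ (fun y => G y y y) z w =
      fderiv ℝ (fun y => G y z z) z w + 2 * G z z w := by
    intro z
    have h1 : HasFDerivAt (fun y => G y y) ((G z).comp (ContinuousLinearMap.id ℝ (Euc k)) +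
        (fderiv ℝ G z).flip z) z :=
      ((hG.differentiable (by simp)) z).hasFDerivAt.clm_apply (hasFDerivAt_id z)
    have h2 : HasFDerivAt (fun y => G y y y) _ z := h1.clm_apply (hasFDerivAt_id z)
    have h3 : HasFDerivAt (fun y => G y z z) (((fderiv ℝ G z).flip z).flip z) z := by
      have h4 := ((hG.differentiable (by simp)) z).hasFDerivAt.clm_apply (hasFDerivAt_const z z)
      have h5 := h4.clm_apply (hasFDerivAt_const z z)
      simpa using h5
    rw [h2.fderiv, h3.fderiv]
    simp [hsymm z w z]
    ring
  -- `τ (G (τ y) y w - ⟨y, w⟩)` vanishes at `τ = 0` and has derivative zero, by the geodesic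
  -- equation combined with the derivative of `G y y y = ⟨y, y⟩` in the direction `w`. That identity
  -- carries a factor `s²`, so `s = 0` is treated apart.
  have hd : ∀ s : ℝ, HasDerivAt (fun τ : ℝ => τ * G (τ • y) y w - τ * inner ℝ y w) 0 s := by
    intro s
    have h1 := ((hasDerivAt_id s).mul (hgeo' y w s)).sub ((hasDerivAt_id s).mul_const (inner ℝ y w))
    refine HasDerivAt.congr_deriv (f := fun τ : ℝ => τ * G (τ • y) y w - τ * inner ℝ y w) h1 ?_
    rcases eq_or_ne s 0 with rfl | hs
    · simp [h0]
    · have h2 := hkey s hs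
      rw [hprod] at h2
      have h3 : fderiv ℝ (fun x => G x (s • y) (s • y)) (s • y) w =
          s ^ 2 * fderiv ℝ (fun x => G x y y) (s • y) w := by
        have : (fun x => G x (s • y) (s • y)) = fun x => s ^ 2 * G x y y := by
          funext x; simp; ring
        rw [this, fderiv_const_mul (hdiff y y _)]
        simp
      rw [h3] at h2
      simp only [map_smul, smul_apply, smul_eq_mul] at h2
      have h4 : s ^ 2 * (1 * (G (s • y)) y w +
          s * (1 / 2 * fderiv ℝ (fun y_1 => G y_1 y y) (s • y) w) - 1 * inner ℝ y w) = 0 := by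
        linear_combination h2
      simpa [hs] using h4
  have := is_const_of_deriv_eq_zero (fun s => (hd s).differentiableAt) (fun s => (hd s).deriv) 1 0
  simpa [sub_eq_zero] using this

section Manifold

variable {k : ℕ} {M : Type u} [TopologicalSpace M] [ChartedSpace (Euc k) M]
  [IsManifold (𝓡 k) ∞ M]

/-- This removes the manifold from the argument: afterwards only smoothness, symmetry, nonnegativity
and the Gauss identity are used. -/
theorem pullbackMetric_isRadialForm
    (g : Bundle.ContMDiffRiemannianMetric (𝓡 k) ∞ (Euc k)
      (fun x : M => TangentSpace (𝓡 k) x))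
    {o : M} {Φ : Diffeomorph (𝓡 k) (𝓡 k) (Euc k) M ∞} (h : IsExpAtCenter g o Φ) :
    ∃ G : Euc k → Euc k →L[ℝ] Euc k →L[ℝ] ℝ, IsRadialForm G ∧
      pullbackMetric g Φ = fun y v w => G y v w := by
  -- Tangent spaces are definitionally the model space; `D` and `γ` fix that reading so that
  -- ordinary linear algebra applies.
  let D : ∀ y : Euc k, Euc k →L[ℝ] Euc k := fun y => mfderiv (𝓡 k) (𝓡 k) Φ y
  let γ : ∀ y : Euc k, Euc k →L[ℝ] Euc k →L[ℝ] ℝ := fun y => g.inner (Φ y)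
  let G : Euc k → Euc k →L[ℝ] Euc k →L[ℝ] ℝ := fun y =>
    (γ y).bilinearComp (D y) (D y)
  have hGeq : pullbackMetric g Φ = fun y v w => G y v w := rfl
  have hsymm : ∀ y v w, G y v w = G y w v := fun y v w => g.symm _ _ _
  have hsm : ContDiff ℝ ∞ G := by
    have hD : ∀ v : Euc k, ContMDiff (𝓡 k) ((𝓡 k).prod 𝓘(ℝ, Euc k)) ∞
        (fun y => (Bundle.TotalSpace.mk' (Euc k) (Φ y) (D y v) :
          Bundle.TotalSpace (Euc k) (fun x : M => TangentSpace (𝓡 k) x))) := by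
      intro v
      have h1 := Φ.contMDiff.contMDiff_tangentMap (m := ∞) (by simp)
      have h2 : ContMDiff (𝓡 k) ((𝓡 k).prod 𝓘(ℝ, Euc k)) ∞
          (fun y : Euc k => (Bundle.TotalSpace.mk' (Euc k) y v :
            TangentBundle (𝓡 k) (Euc k))) := by
        exact (contMDiff_vectorSpace_iff_contDiff (V := fun _ : Euc k => v)).2 contDiff_const
      exact h1.comp h2
    rw [contDiff_clm_apply_iff]
    intro v
    rw [contDiff_clm_apply_iff]
    intro w
    rw [← contMDiff_iff_contDiff]
    have hg : ContMDiff (𝓡 k) ((𝓡 k).prod 𝓘(ℝ, Euc k →L[ℝ] Euc k →L[ℝ] ℝ)) ∞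
        (fun y => Bundle.TotalSpace.mk' (Euc k →L[ℝ] Euc k →L[ℝ] ℝ)
          (E := fun x : M => (TangentSpace (𝓡 k) x →L[ℝ] TangentSpace (𝓡 k) x →L[ℝ] ℝ))
          (Φ y) (g.inner (Φ y))) := g.contMDiff.comp Φ.contMDiff
    have h3 := ContMDiff.clm_bundle_apply₂ (F₁ := Euc k) (F₂ := Euc k) (F₃ := ℝ)
      (E₃ := Bundle.Trivial M ℝ) hg (hD v) (hD w)
    intro y
    have h4 := h3 y
    rw [Bundle.contMDiffAt_totalSpace] at h4
    exact h4.2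
  have h0 : ∀ v w, G 0 v w = inner ℝ v w := fun v w => by
    rw [← h.isometry_zero v w, hGeq]
  have hgeo := h.geodesic
  rw [hGeq] at hgeo
  have hpos : ∀ y (v : Euc k), v ≠ 0 → 0 < γ y v v := fun y v hv => g.pos (Φ y) v hv
  have hnn : ∀ y v, 0 ≤ G y v v := fun y v => by
    rcases eq_or_ne (D y v) 0 with h0 | h0
    · change 0 ≤ γ y (D y v) (D y v)
      rw [h0]; simp
    · exact (hpos y (D y v) h0).le
  exact ⟨G, ⟨hsm, hsymm, hnn, gauss_lemma hsm hsymm h0 hgeo⟩, hGeq⟩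

end Manifold

/-! ### Radial charts and pull-backs of polar metrics. -/

theorem isOpen_modelSet (m : ℕ) (ξ : ℝ) : IsOpen (modelSet m ξ) :=
  Metric.isOpen_ball.prod isOpen_Ioo

theorem convex_modelSet (m : ℕ) (ξ : ℝ) : Convex ℝ (modelSet m ξ) :=
  (convex_ball _ _).prod (convex_Ioo _ _)

theorem modelSet_mono (m : ℕ) {ξ ξ' : ℝ} (h : ξ ≤ ξ') : modelSet m ξ ⊆ modelSet m ξ' :=
  Set.prod_mono le_rfl (Set.Ioo_subset_Ioo (by linarith) (by linarith))

theorem zero_mem_modelSet (m : ℕ) {ξ : ℝ} (h : 0 < 1 + ξ) : (0 : ModelSpace m) ∈ modelSet m ξ :=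
  ⟨by simp, by simp only [Prod.snd_zero]; constructor <;> linarith⟩

theorem IsRadialChart.mono {m : ℕ} {ξ ξ' : ℝ} {φ : ModelSpace m → Euc (m + 1)}
    (h : IsRadialChart ξ' φ) (hξ : ξ ≤ ξ') : IsRadialChart ξ φ := by
  have hs := modelSet_mono m hξ
  obtain ⟨φ₁, a, H⟩ := h.radial
  exact ⟨h.smooth.mono hs, h.injOn.mono hs, fun z hz => h.immersion z (hs hz),
    φ₁, a, fun z hz => H z (hs hz)⟩

/-- `φ(x, t) = (t + a) φ₁(x)` on the model set, where `φ₁` is a smooth map to the unit sphere. -/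
structure IsPolarMap {m : ℕ} (ξ : ℝ) (φ : ModelSpace m → Euc (m + 1)) (φ₁ : Euc m → Euc (m + 1))
    (a : ℝ) : Prop where
  smooth : ContDiffOn ℝ ∞ φ₁ (Metric.ball 0 1)
  norm_eq : ∀ x ∈ Metric.ball (0 : Euc m) 1, ‖φ₁ x‖ = 1
  pos : ∀ t ∈ Set.Ioo (-(1 + ξ)) (1 + ξ), 0 < t + a
  eq : ∀ z ∈ modelSet m ξ, φ z = (z.2 + a) • φ₁ z.1

/-- A radial chart does not come with smoothness of its spherical factor. It is recovered from the
slice `t = 0`, where `φ₁ = a⁻¹ φ(·, 0)` and `a > 0`. -/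
theorem IsRadialChart.exists_isPolarMap {m : ℕ} {ξ : ℝ} {φ : ModelSpace m → Euc (m + 1)}
    (h : IsRadialChart ξ φ) (hξ : 0 < 1 + ξ) : ∃ φ₁ a, IsPolarMap ξ φ φ₁ a := by
  obtain ⟨φ₁, a, H⟩ := h.radial
  have hmem : (0 : ℝ) ∈ Set.Ioo (-(1 + ξ)) (1 + ξ) := ⟨by linarith, hξ⟩
  have h0 : ∀ x ∈ Metric.ball (0 : Euc m) 1, ((x, (0 : ℝ)) : ModelSpace m) ∈ modelSet m ξ :=
    fun x hx => ⟨hx, hmem⟩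
  have hpos : ∀ t ∈ Set.Ioo (-(1 + ξ)) (1 + ξ), 0 < t + a := fun t ht =>
    (H (0, t) ⟨by simp, ht⟩).2.1
  refine ⟨φ₁, a, ?_, fun x hx => (H _ (h0 x hx)).1, hpos, fun z hz => (H z hz).2.2⟩
  have ha : 0 < a := by simpa using hpos 0 hmem
  have h1 : ContDiffOn ℝ ∞ (fun x : Euc m => a⁻¹ • φ (x, 0)) (Metric.ball 0 1) :=
    (h.smooth.comp (by fun_prop) h0).const_smul a⁻¹
  refine h1.congr fun x hx => ?_
  rw [(H _ (h0 x hx)).2.2]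
  simp [smul_smul, inv_mul_cancel₀ ha.ne']

theorem inner_fderiv_of_norm_eq_one {E F : Type*} [NormedAddCommGroup E] [NormedSpace ℝ E]
    [NormedAddCommGroup F] [InnerProductSpace ℝ F] {U : Set E} (hU : IsOpen U) {f : E → F}
    (hf : ∀ x ∈ U, ‖f x‖ = 1) {x : E} (hx : x ∈ U) (hd : DifferentiableAt ℝ f x) (v : E) :
    inner ℝ (f x) (fderiv ℝ f x v) = 0 := by
  have h1 : HasFDerivAt (fun x => inner ℝ (f x) (f x)) _ x := hd.hasFDerivAt.inner ℝ hd.hasFDerivAt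
  have h2 : (fun x => inner ℝ (f x) (f x)) =ᶠ[nhds x] fun _ => (1 : ℝ) := by
    refine Filter.eventuallyEq_of_mem (hU.mem_nhds hx) fun y hy => ?_
    simp [hf y hy]
  have h3 := (h1.congr_of_eventuallyEq h2.symm).unique (hasFDerivAt_const (1 : ℝ) x)
  have h4 := congrArg (fun T => T v) h3
  simp [real_inner_comm (f x)] at h4
  linarith

namespace IsPolarMap

variable {m : ℕ} {ξ : ℝ} {φ : ModelSpace m → Euc (m + 1)} {φ₁ : Euc m → Euc (m + 1)} {a : ℝ}

theorem differentiableAt (h : IsPolarMap ξ φ φ₁ a) {x : Euc m} (hx : x ∈ Metric.ball (0 : Euc m) 1) :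
    DifferentiableAt ℝ φ₁ x :=
  (h.smooth.contDiffAt (Metric.isOpen_ball.mem_nhds hx)).differentiableAt (by simp)

theorem contDiffOn (h : IsPolarMap ξ φ φ₁ a) : ContDiffOn ℝ ∞ φ (modelSet m ξ) := by
  have h1 : ContDiffOn ℝ ∞ (fun z : ModelSpace m => (z.2 + a) • φ₁ z.1) (modelSet m ξ) :=
    (contDiff_snd.add contDiff_const).contDiffOn.smul
      (h.smooth.comp contDiff_fst.contDiffOn fun z hz => hz.1)
  exact h1.congr h.eq

theorem fderiv_apply (h : IsPolarMap ξ φ φ₁ a) {z : ModelSpace m} (hz : z ∈ modelSet m ξ)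
    (v : ModelSpace m) :
    fderiv ℝ φ z v = v.2 • φ₁ z.1 + (z.2 + a) • fderiv ℝ φ₁ z.1 v.1 := by
  have h1 : φ =ᶠ[nhds z] fun z => (z.2 + a) • φ₁ z.1 :=
    Filter.eventuallyEq_of_mem ((isOpen_modelSet m ξ).mem_nhds hz) h.eq
  rw [h1.fderiv_eq]
  have h2 : HasFDerivAt (fun z : ModelSpace m => z.2 + a) (ContinuousLinearMap.snd ℝ (Euc m) ℝ) z :=
    hasFDerivAt_snd.add_const a
  have h3 : HasFDerivAt (fun z : ModelSpace m => φ₁ z.1)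
      ((fderiv ℝ φ₁ z.1).comp (ContinuousLinearMap.fst ℝ (Euc m) ℝ)) z :=
    (h.differentiableAt hz.1).hasFDerivAt.comp z hasFDerivAt_fst
  have h4 : HasFDerivAt (fun z : ModelSpace m => (z.2 + a) • φ₁ z.1) _ z := h2.smul h3
  rw [h4.fderiv]
  simp [add_comm]

theorem inner_fderiv (h : IsPolarMap ξ φ φ₁ a) {x : Euc m} (hx : x ∈ Metric.ball (0 : Euc m) 1)
    (v : Euc m) : inner ℝ (φ₁ x) (fderiv ℝ φ₁ x v) = 0 :=
  inner_fderiv_of_norm_eq_one Metric.isOpen_ball h.norm_eq hx (h.differentiableAt hx) v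

theorem norm_map (h : IsPolarMap ξ φ φ₁ a) {z : ModelSpace m} (hz : z ∈ modelSet m ξ) :
    ‖φ z‖ = z.2 + a := by
  rw [h.eq z hz, norm_smul, h.norm_eq _ hz.1, mul_one, Real.norm_eq_abs, abs_of_pos (h.pos _ hz.2)]

theorem map_ne_zero (h : IsPolarMap ξ φ φ₁ a) {z : ModelSpace m} (hz : z ∈ modelSet m ξ) :
    φ z ≠ 0 := by
  rw [← norm_pos_iff, h.norm_map hz]
  exact h.pos _ hz.2

/-- Since `φ₁` is orthogonal to the image of its differential, `dφ` splits into radial part `v.2`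
and tangential part `(t+a) dφ₁`; the factor `t+a` cancels the `‖y‖⁻¹` of `polarMetric`. -/
theorem pullback_polarMetric (h : IsPolarMap ξ φ φ₁ a) (k : ℝ → TensorField (m + 1))
    {z : ModelSpace m} (hz : z ∈ modelSet m ξ) (v w : ModelSpace m) :
    pullbackModel φ (polarMetric k) z v w =
      k (z.2 + a) (φ₁ z.1) (fderiv ℝ φ₁ z.1 v.1) (fderiv ℝ φ₁ z.1 w.1) + v.2 * w.2 := by
  have hr := (h.pos _ hz.2)
  have h1 : ‖φ z‖⁻¹ • φ z = φ₁ z.1 := by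
    rw [h.norm_map hz, h.eq z hz, smul_smul, inv_mul_cancel₀ hr.ne', one_smul]
  have h2 : ∀ v : ModelSpace m, inner ℝ (φ₁ z.1) (fderiv ℝ φ z v) = v.2 := fun v => by
    rw [h.fderiv_apply hz, inner_add_right, inner_smul_right, inner_smul_right,
      h.inner_fderiv hz.1, real_inner_self_eq_norm_sq, h.norm_eq _ hz.1]
    simp
  have h3 : ∀ v : ModelSpace m, (z.2 + a)⁻¹ • tangPart (φ₁ z.1) (fderiv ℝ φ z v) =
      fderiv ℝ φ₁ z.1 v.1 := fun v => by
    rw [tangPart, h2, h.fderiv_apply hz, add_sub_cancel_left, smul_smul, inv_mul_cancel₀ hr.ne',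
      one_smul]
  simp only [pullbackModel, polarMetric]
  rw [h1, h.norm_map hz, h3, h3, h2, h2]

end IsPolarMap

/-- The family of metrics on the sphere given by the metric after hyperbolic forcing. -/
noncomputable def forcedCut {k : ℕ} (ρT ρW : ℝ → ℝ) (r₀ d : ℝ) (G : TensorField k) (r : ℝ) :
    TensorField k := fun u v w =>
  (1 - ρT (2 * ((r - (r₀ - d)) / d))) * (Real.sinh r ^ 2 * inner ℝ v w) +
    ρT (2 * ((r - (r₀ - d)) / d)) * ((1 - ρW (r - r₀)) * (Real.sinh r ^ 2 *
      sphericalCut G r₀ u v w) + ρW (r - r₀) * warpedCut G r u v w)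

namespace IsRadialForm

variable {k : ℕ} {G : Euc k → Euc k →L[ℝ] Euc k →L[ℝ] ℝ}

/-- By the Gauss identity the unit radial vector pairs with anything as in the Euclidean product, so
the cross terms between radial and tangential parts vanish. -/
theorem eq_polarMetric (hG : IsRadialForm G) {y : Euc k} (hy : y ≠ 0) (v w : Euc k) :
    G y v w = polarMetric (warpedCut fun y v w => G y v w) y v w := by
  have hr : ‖y‖ ≠ 0 := norm_ne_zero_iff.2 hy
  have hu : ∀ w, G y (‖y‖⁻¹ • y) w = inner ℝ (‖y‖⁻¹ • y) w := fun w => by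
    simp [hG.gauss, inner_smul_left]
  have huu : inner ℝ (‖y‖⁻¹ • y) (‖y‖⁻¹ • y) = (1 : ℝ) := by
    rw [real_inner_self_eq_norm_sq, norm_smul, norm_inv, norm_norm, inv_mul_cancel₀ hr, one_pow]
  simp only [polarMetric, warpedCut, smul_smul, mul_inv_cancel₀ hr, one_smul]
  generalize ‖y‖⁻¹ • y = u at *
  simp only [tangPart, map_sub, sub_apply]
  rw [map_smul, map_smul, map_smul, smul_apply, smul_apply, hG.symm y v u, hu, hu, hu, huu]
  simp only [smul_eq_mul]
  ring

theorem hypForce_eq_polarMetric (hG : IsRadialForm G) (ρT ρW : ℝ → ℝ) (r₀ d : ℝ) {y : Euc k}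
    (hy : y ≠ 0) (v w : Euc k) :
    hypForce ρT ρW r₀ d (fun y v w => G y v w) y v w =
      polarMetric (forcedCut ρT ρW r₀ d fun y v w => G y v w) y v w := by
  simp only [hypForce, warpTrick, warpForce]
  rw [hG.eq_polarMetric hy]
  simp only [hypMetric, sinhWarped, polarMetric, forcedCut, Pi.smul_apply, smul_eq_mul, roundMetric]
  ring

variable {m : ℕ} {G : Euc (m + 1) → Euc (m + 1) →L[ℝ] Euc (m + 1) →L[ℝ] ℝ} {ξ : ℝ}
  {φ : ModelSpace m → Euc (m + 1)} {φ₁ : Euc m → Euc (m + 1)} {a : ℝ}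

theorem pullback_eq (hG : IsRadialForm G) (h : IsPolarMap ξ φ φ₁ a)
    {z : ModelSpace m} (hz : z ∈ modelSet m ξ) (v w : ModelSpace m) :
    pullbackModel φ (fun y v w => G y v w) z v w =
      G ((z.2 + a) • φ₁ z.1) ((z.2 + a) • fderiv ℝ φ₁ z.1 v.1)
        ((z.2 + a) • fderiv ℝ φ₁ z.1 w.1) + v.2 * w.2 := by
  refine Eq.trans ?_ (h.pullback_polarMetric (warpedCut fun y v w => G y v w) hz v w)
  exact hG.eq_polarMetric (h.map_ne_zero hz) _ _

theorem pullback_hypForce (hG : IsRadialForm G) (ρT ρW : ℝ → ℝ) (r₀ d : ℝ)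
    (h : IsPolarMap ξ φ φ₁ a) {z : ModelSpace m} (hz : z ∈ modelSet m ξ) (v w : ModelSpace m) :
    pullbackModel φ (hypForce ρT ρW r₀ d fun y v w => G y v w) z v w =
      forcedCut ρT ρW r₀ d (fun y v w => G y v w) (z.2 + a) (φ₁ z.1) (fderiv ℝ φ₁ z.1 v.1)
        (fderiv ℝ φ₁ z.1 w.1) + v.2 * w.2 := by
  rw [← h.pullback_polarMetric _ hz]
  exact hG.hypForce_eq_polarMetric ρT ρW r₀ d (h.map_ne_zero hz) _ _

/-- `c2Norm` only bounds Fréchet derivatives and does not imply differentiability, so this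
regularity is needed to turn closeness into a `C2BoundedOn` estimate. -/
theorem contDiffOn_pullback (hG : IsRadialForm G) (h : IsPolarMap ξ φ φ₁ a) (v w : ModelSpace m) :
    ContDiffOn ℝ 2 (fun z => pullbackModel φ (fun y v w => G y v w) z v w - modelMetric m z v w)
      (modelSet m ξ) := by
  have h1 := h.contDiffOn
  have h2 : ContDiffOn ℝ ∞ (fderiv ℝ φ) (modelSet m ξ) :=
    h1.fderiv_of_isOpen (isOpen_modelSet m ξ) (by simp)
  have h3 : ContDiffOn ℝ ∞ (fun z => pullbackModel φ (fun y v w => G y v w) z v w)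
      (modelSet m ξ) :=
    ((hG.smooth.comp_contDiffOn h1).clm_apply (h2.clm_apply contDiffOn_const)).clm_apply
      (h2.clm_apply contDiffOn_const)
  have h4 : ContDiffOn ℝ ∞ (fun z => modelMetric m z v w) (modelSet m ξ) := by
    unfold modelMetric; fun_prop
  exact contDiffOn_infty.1 (h3.sub h4) 2

end IsRadialForm

theorem abs_inner_modelBasis_le {m : ℕ} (i j : Fin m ⊕ Unit) :
    |inner ℝ (modelBasis m i).1 (modelBasis m j).1| ≤ 1 := by
  have h : ∀ i, ‖(modelBasis m i).1‖ ≤ 1 := by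
    rintro (i | i) <;> simp [modelBasis]
  calc _ ≤ ‖(modelBasis m i).1‖ * ‖(modelBasis m j).1‖ := abs_real_inner_le_norm _ _
    _ ≤ 1 * 1 := mul_le_mul (h i) (h j) (norm_nonneg _) zero_le_one
    _ = 1 := one_mul 1

/-! ### Exponentials and `sinh²` on the model set. -/

section ExpBounds

variable {m : ℕ} {ξ : ℝ}

theorem C2BoundedOn.comp_smul_snd {U : Set (ModelSpace m)} {V : Set ℝ} {f : ℝ → ℝ} {K s : ℝ}
    (hV : IsOpen V) (hf : C2BoundedOn V f K) (hs : |s| ≤ 1) (c : ℝ) (hUV : ∀ z ∈ U, c + s * z.2 ∈ V) :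
    C2BoundedOn U (fun z => f (c + s * z.2)) K := by
  have h := hf.comp_affine hV (U := U) (s • ContinuousLinearMap.snd ℝ (Euc m) ℝ) (by
    rw [norm_smul]
    exact mul_le_one₀ hs (norm_nonneg _) (ContinuousLinearMap.norm_snd_le _ _ _)) c
    (by simpa using hUV)
  simpa using h

theorem c2BoundedOn_exp_snd (m : ℕ) (ξ : ℝ) :
    C2BoundedOn (modelSet m ξ) (fun z => Real.exp (2 * z.2)) (4 * Real.exp (2 * (1 + ξ))) := by
  have h := (c2BoundedOn_exp_two_mul (R := 1 + ξ)).comp_smul_snd (U := modelSet m ξ) (s := 1)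
    isOpen_Iio (by simp) 0 (fun z hz => by simpa using hz.2.2)
  simpa using h

theorem c2BoundedOn_exp_neg_snd (m : ℕ) (ξ : ℝ) :
    C2BoundedOn (modelSet m ξ) (fun z => Real.exp (-(2 * z.2))) (4 * Real.exp (2 * (1 + ξ))) := by
  have h := (c2BoundedOn_exp_two_mul (R := 1 + ξ)).comp_smul_snd (U := modelSet m ξ) (s := -1)
    isOpen_Iio (by simp) 0 (fun z hz => by
      have := hz.2.1
      simp only [Set.mem_Iio]; linarith)
  simpa using h

/-- A combination of `e^{2t}`, `1` and `e^{-2t}` with small coefficients is `C²`-small. -/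
theorem c2BoundedOn_exp_combination (m : ℕ) (ξ a b c : ℝ) :
    C2BoundedOn (modelSet m ξ)
      (fun z => a * Real.exp (2 * z.2) + b + c * Real.exp (-(2 * z.2)))
      (4 * Real.exp (2 * (1 + ξ)) * (|a| + |c|) + |b|) := by
  have hU := isOpen_modelSet m ξ
  refine ((((c2BoundedOn_exp_snd m ξ).const_mul hU a).add hU (C2BoundedOn.const _ b)).add hU
    ((c2BoundedOn_exp_neg_snd m ξ).const_mul hU c)).mono ?_
  linarith

theorem four_mul_sinh_sq (r : ℝ) :
    4 * Real.sinh r ^ 2 = Real.exp (2 * r) - 2 + Real.exp (-(2 * r)) := by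
  have h1 : Real.exp (2 * r) = Real.exp r ^ 2 := by rw [← Real.exp_nat_mul]; norm_num
  have h2 : Real.exp (-(2 * r)) = Real.exp (-r) ^ 2 := by rw [← Real.exp_nat_mul]; norm_num
  have h3 : Real.exp r * Real.exp (-r) = 1 := by rw [← Real.exp_add]; simp
  rw [Real.sinh_eq, h1, h2]
  linear_combination -2 * h3

theorem exp_le_four_mul_sinh_sq {r : ℝ} (hr : 1 ≤ r) :
    Real.exp (2 * r) ≤ 2 * (4 * Real.sinh r ^ 2) := by
  rw [four_mul_sinh_sq]
  have h1 : Real.exp 2 ≤ Real.exp (2 * r) := Real.exp_le_exp.2 (by linarith)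
  have h2 : (4 : ℝ) ≤ Real.exp 2 := by
    have h := Real.exp_one_gt_d9
    have : Real.exp 2 = Real.exp 1 ^ 2 := by rw [← Real.exp_nat_mul]; norm_num
    rw [this]
    nlinarith
  linarith [Real.exp_pos (-(2 * r))]

end ExpBounds

theorem c2BoundedOn_cutoff {ρ : ℝ → ℝ} {B : ℝ} (hB : 1 ≤ B) (hρ : ContDiff ℝ ∞ ρ)
    (h01 : ∀ t, ρ t ∈ Set.Icc (0 : ℝ) 1)
    (hρB : ∀ t, |deriv ρ t| ≤ B ∧ |deriv (deriv ρ) t| ≤ B) :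
    C2BoundedOn Set.univ ρ B ∧ C2BoundedOn Set.univ (fun t => 1 - ρ t) B := by
  constructor
  · refine c2BoundedOn_of_deriv_le hρ (fun t _ => ?_) (fun t _ => (hρB t).1) fun t _ => (hρB t).2
    rw [abs_of_nonneg (h01 t).1]
    exact (h01 t).2.trans hB
  · have hd1 : deriv (fun t => 1 - ρ t) = fun t => -deriv ρ t := by
      funext t; simp
    refine c2BoundedOn_of_deriv_le (contDiff_const.sub hρ) (fun t _ => ?_)
      (fun t _ => ?_) (fun t _ => ?_)
    · rw [abs_of_nonneg (by linarith [(h01 t).2])]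
      linarith [(h01 t).1]
    · rw [hd1, abs_neg]; exact (hρB t).1
    · rw [hd1]
      simpa using (hρB t).2

/-! ### Warp forcing near and beyond the sphere of radius `r₀`. -/

section WarpForcing

variable {m : ℕ} {ξ a r₀ : ℝ}

theorem sinh_sq_eq (a t : ℝ) : 4 * Real.sinh (t + a) ^ 2 =
    Real.exp (2 * a) * Real.exp (2 * t) + -2 + Real.exp (-(2 * a)) * Real.exp (-(2 * t)) := by
  rw [four_mul_sinh_sq, ← Real.exp_add, ← Real.exp_add]
  ring_nf

/-- `4 sinh²(t+a)` is a combination of `e^{2t}`, `1`, `e^{-2t}`. Dividing by `4 sinh²(r₀) ≥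
e^{2r₀}/2` leaves coefficients bounded through `e^{2a-2r₀} ≤ e^{1+2ξ}`. -/
theorem c2BoundedOn_sinh_ratio (hξ : 1 < ξ) (hr₀ : 1 ≤ r₀) (ha : 0 ≤ a) (ha' : a ≤ r₀ + ξ + 1 / 2) :
    C2BoundedOn (modelSet m (ξ - 1)) (fun z => Real.sinh (z.2 + a) ^ 2 / Real.sinh r₀ ^ 2)
      (34 * Real.exp (4 * ξ)) := by
  have hS := exp_le_four_mul_sinh_sq hr₀
  set S := 4 * Real.sinh r₀ ^ 2 with hSdef
  have hSpos : 0 < S := by linarith [Real.exp_pos (2 * r₀)]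
  have hb : ∀ x, Real.exp x / S ≤ 2 * Real.exp (x - 2 * r₀) := fun x => by
    rw [div_le_iff₀ hSpos, Real.exp_sub, mul_div_assoc', div_mul_eq_mul_div,
      le_div_iff₀ (Real.exp_pos _)]
    nlinarith [Real.exp_pos x]
  have h := c2BoundedOn_exp_combination m (ξ - 1) (Real.exp (2 * a) / S) (-2 / S)
    (Real.exp (-(2 * a)) / S)
  refine (h.mono ?_).congr (isOpen_modelSet _ _) fun z _ => ?_
  · rw [abs_of_pos (by positivity), abs_of_pos (a := Real.exp (-(2 * a)) / S) (by positivity),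
      neg_div, abs_neg, abs_of_pos (a := 2 / S) (by positivity)]
    have h1 : Real.exp (2 * a) / S ≤ 2 * (3 * Real.exp (2 * ξ)) := by
      refine (hb _).trans ?_
      have : Real.exp (2 * a - 2 * r₀) ≤ Real.exp (1 + 2 * ξ) := Real.exp_le_exp.2 (by linarith)
      rw [Real.exp_add] at this
      nlinarith [Real.exp_one_lt_d9, Real.exp_pos (2 * ξ)]
    have h2 : Real.exp (-(2 * a)) / S ≤ 2 := by
      refine (hb _).trans ?_
      have : Real.exp (-(2 * a) - 2 * r₀) ≤ 1 := Real.exp_le_one_iff.2 (by linarith)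
      linarith
    have h3 : 2 / S ≤ 4 := by
      have := hb 0
      have h4 : Real.exp (0 - 2 * r₀) ≤ 1 := Real.exp_le_one_iff.2 (by linarith)
      rw [Real.exp_zero] at this
      have h5 : 2 / S = 2 * (1 / S) := by ring
      rw [h5]; linarith
    have h4 : Real.exp (4 * ξ) = Real.exp (2 * ξ) * Real.exp (2 * ξ) := by
      rw [← Real.exp_add]; ring_nf
    have h5 : 4 ≤ Real.exp (2 * ξ) := by
      have h := Real.exp_one_gt_d9
      have h6 : Real.exp 2 = Real.exp 1 ^ 2 := by rw [← Real.exp_nat_mul]; norm_num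
      have : Real.exp 2 ≤ Real.exp (2 * ξ) := Real.exp_le_exp.2 (by linarith)
      nlinarith
    rw [show 2 * (1 + (ξ - 1)) = 2 * ξ by ring, h4]
    nlinarith
  · have h6 := sinh_sq_eq a z.2
    have h7 : Real.sinh (z.2 + a) ^ 2 / Real.sinh r₀ ^ 2 = (4 * Real.sinh (z.2 + a) ^ 2) / S := by
      rw [hSdef, mul_div_mul_left _ _ (by norm_num : (4 : ℝ) ≠ 0)]
    rw [h7, h6]
    ring

/-- With `S = 4 sinh²(r₀)`, the leading coefficient is `e^{2a} e^{2(r₀-a)} = e^{2r₀} = S + 2 -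
e^{-2r₀}`. The part `S` cancels against `e^{2t}`, and every remaining coefficient is at most a
constant times `e^{-b}`. -/
theorem c2BoundedOn_sinh_ratio_sub_exp {b : ℝ} (hξ : 1 < ξ) (hr₀ : 1 ≤ r₀) (hb0 : 0 ≤ b)
    (hbr : b ≤ r₀) (hba : b ≤ a) :
    C2BoundedOn (modelSet m (ξ - 1))
      (fun z => Real.sinh (z.2 + a) ^ 2 / Real.sinh r₀ ^ 2 * Real.exp (2 * (r₀ - a))
        - Real.exp (2 * z.2)) (28 * Real.exp (2 * ξ) * Real.exp (-b)) := by
  have hS := exp_le_four_mul_sinh_sq hr₀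
  have hSeq := four_mul_sinh_sq r₀
  set S := 4 * Real.sinh r₀ ^ 2 with hSdef
  have hSpos : 0 < S := by linarith [Real.exp_pos (2 * r₀)]
  have hb : ∀ x, Real.exp x / S ≤ 2 * Real.exp (x - 2 * r₀) := fun x => by
    rw [div_le_iff₀ hSpos, Real.exp_sub, mul_div_assoc', div_mul_eq_mul_div,
      le_div_iff₀ (Real.exp_pos _)]
    nlinarith [Real.exp_pos x]
  have hb' : ∀ x, x - 2 * r₀ ≤ -b → Real.exp x / S ≤ 2 * Real.exp (-b) := fun x hx =>
    (hb x).trans (by have := Real.exp_le_exp.2 hx; linarith)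
  have h := c2BoundedOn_exp_combination m (ξ - 1) ((2 - Real.exp (-(2 * r₀))) / S)
    (-(2 * (Real.exp (2 * (r₀ - a)) / S))) (Real.exp (2 * (r₀ - a) - 2 * a) / S)
  refine (h.mono ?_).congr (isOpen_modelSet _ _) fun z _ => ?_
  · have h0 : Real.exp (-(2 * r₀)) ≤ 1 := Real.exp_le_one_iff.2 (by linarith)
    have h0' := Real.exp_pos (-(2 * r₀))
    rw [abs_of_nonneg (div_nonneg (by linarith) hSpos.le),
      abs_of_pos (a := Real.exp (2 * (r₀ - a) - 2 * a) / S) (by positivity),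
      abs_neg, abs_of_pos (a := 2 * (Real.exp (2 * (r₀ - a)) / S)) (by positivity)]
    have h1 : (2 - Real.exp (-(2 * r₀))) / S ≤ 4 * Real.exp (-b) := by
      have h2 := hb' 0 (by linarith)
      have h3 : (2 - Real.exp (-(2 * r₀))) / S ≤ 2 * (Real.exp 0 / S) := by
        rw [Real.exp_zero, mul_div_assoc', mul_one]
        gcongr
        linarith
      linarith
    have h2 := hb' (2 * (r₀ - a)) (by linarith)
    have h3 := hb' (2 * (r₀ - a) - 2 * a) (by linarith)
    have h5 : 1 ≤ Real.exp (2 * ξ) := Real.one_le_exp (by linarith)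
    rw [show 2 * (1 + (ξ - 1)) = 2 * ξ by ring]
    nlinarith [Real.exp_pos (-b)]
  · have h6 := sinh_sq_eq a z.2
    have h7 : Real.sinh (z.2 + a) ^ 2 / Real.sinh r₀ ^ 2 = (4 * Real.sinh (z.2 + a) ^ 2) / S := by
      rw [hSdef, mul_div_mul_left _ _ (by norm_num : (4 : ℝ) ≠ 0)]
    have h8 : Real.exp (2 * a) * Real.exp (2 * (r₀ - a)) = S + 2 - Real.exp (-(2 * r₀)) := by
      rw [hSeq, ← Real.exp_add]; ring_nf
    have h9 : Real.exp (2 * (r₀ - a) - 2 * a) = Real.exp (-(2 * a)) * Real.exp (2 * (r₀ - a)) := by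
      rw [← Real.exp_add]; ring_nf
    rw [h7, h6, h9]
    field_simp
    linear_combination Real.exp (2 * z.2) * h8

/-- The estimate for the forced metric in a chart that is close to hyperbolic for the original
metric. -/
theorem c2BoundedOn_hypForce_of_epsClose {G : Euc (m + 1) → Euc (m + 1) →L[ℝ] Euc (m + 1) →L[ℝ] ℝ}
    (hG : IsRadialForm G) {ρT ρW : ℝ → ℝ} (hρT : ∀ t, 1 ≤ t → ρT t = 1)
    {B : ℝ} (hB : 1 ≤ B) (hρW : IsWarpForcingCutoff ρW)
    (hρB : ∀ t, |deriv ρW t| ≤ B ∧ |deriv (deriv ρW) t| ≤ B)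
    {d ε : ℝ} (hξ : 1 < ξ) (hd : 4 * (1 + ξ) ≤ d) (hrd : 2 * ξ ≤ r₀ - d)
    {φ : ModelSpace m → Euc (m + 1)} {φ₁ : Euc m → Euc (m + 1)} (h : IsPolarMap ξ φ φ₁ a)
    (ha : r₀ - ξ ≤ a)
    (hclose : EpsCloseToModel ξ ε (pullbackModel φ fun y v w => G y v w)) (i j : Fin m ⊕ Unit) :
    C2BoundedOn (modelSet m (ξ - 1))
      (fun z => pullbackModel φ (hypForce ρT ρW r₀ d fun y v w => G y v w) z
        (modelBasis m i) (modelBasis m j) - modelMetric m z (modelBasis m i) (modelBasis m j))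
      (112 * B * Real.exp (2 * ξ) * Real.exp (-(r₀ - d)) + 548 * B * Real.exp (4 * ξ) * ε) := by
  have hU := isOpen_modelSet m (ξ - 1)
  set v := modelBasis m i
  set w := modelBasis m j
  set A : ModelSpace m → ℝ := fun z =>
    pullbackModel φ (fun y v w => G y v w) z v w - modelMetric m z v w with hAdef
  have hA : C2BoundedOn (modelSet m ξ) A ε :=
    .of_c2Norm_lt (hG.contDiffOn_pullback h v w) (hclose i j)
  have hsub : modelSet m (ξ - 1) ⊆ modelSet m ξ := modelSet_mono m (by linarith)
  have hε : 0 ≤ ε := (norm_nonneg _).trans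
    (hA.2 0 (by norm_num) 0 (zero_mem_modelSet m (by linarith)))
  -- In the smaller chart `r > r₀ - 2ξ ≥ r₀ - d/2`, so the warping trick has no effect.
  have hT : ∀ z ∈ modelSet m (ξ - 1), ρT (2 * ((z.2 + a - (r₀ - d)) / d)) = 1 := fun z hz => by
    refine hρT _ ?_
    have h1 := hz.2.1
    rw [mul_div_assoc', le_div_iff₀ (by linarith)]
    linarith
  have hform : ∀ z ∈ modelSet m (ξ - 1),
      pullbackModel φ (hypForce ρT ρW r₀ d fun y v w => G y v w) z v w =
      (1 - ρW (z.2 + a - r₀)) * (Real.sinh (z.2 + a) ^ 2 / Real.sinh r₀ ^ 2 *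
        G (r₀ • φ₁ z.1) (r₀ • fderiv ℝ φ₁ z.1 v.1) (r₀ • fderiv ℝ φ₁ z.1 w.1))
      + ρW (z.2 + a - r₀) * (A z + Real.exp (2 * z.2) * inner ℝ v.1 w.1) + v.2 * w.2 := by
    intro z hz
    have h1 := hG.pullback_eq h (hsub hz) v w
    have h2 : A z + Real.exp (2 * z.2) * inner ℝ v.1 w.1 =
      G ((z.2 + a) • φ₁ z.1) ((z.2 + a) • fderiv ℝ φ₁ z.1 v.1)
        ((z.2 + a) • fderiv ℝ φ₁ z.1 w.1) := by
      simp only [hAdef, h1, modelMetric]; ring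
    rw [hG.pullback_hypForce ρT ρW r₀ d h (hsub hz), h2]
    simp only [forcedCut, hT z hz, sphericalCut, warpedCut, Pi.smul_apply, smul_eq_mul]
    ring
  have hexp : 0 < Real.exp (-(r₀ - d)) := Real.exp_pos _
  have h4 : 1 ≤ Real.exp (4 * ξ) := Real.one_le_exp (by linarith)
  -- Here the loss of excess matters. If `a > r₀ + ξ + 1/2`, the smaller chart stays beyond `r₀ +
  -- 1/2` and the metric is unchanged there. Otherwise `|r₀ - a| < 1 + ξ`, so the slice `r = r₀` is
  -- inside the original chart.
  rcases lt_or_ge (r₀ + ξ + 1 / 2) a with hfar | hnear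
  · have h1 : ∀ z ∈ modelSet m (ξ - 1), ρW (z.2 + a - r₀) = 1 := fun z hz => by
      obtain ⟨δ, hδ, -, h1⟩ := hρW.plateaus
      have := hz.2.1
      exact h1 _ (by linarith)
    refine ((hA.mono_set hsub).mono ?_).congr hU fun z hz => ?_
    · have : 1 ≤ 548 * B * Real.exp (4 * ξ) := by nlinarith
      have h5 : 0 ≤ 112 * B * Real.exp (2 * ξ) * Real.exp (-(r₀ - d)) := by positivity
      nlinarith
    · rw [hform z hz, h1 z hz, modelMetric]
      ring
  · have ht₀ : ∀ z ∈ modelSet m (ξ - 1), ((z.1, r₀ - a) : ModelSpace m) ∈ modelSet m ξ := fun z hz =>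
      ⟨hz.1, by constructor <;> simp only <;> linarith⟩
    have hA₀ : C2BoundedOn (modelSet m (ξ - 1)) (fun z => A (z.1, r₀ - a)) ε := by
      have hnorm : ‖(ContinuousLinearMap.inl ℝ (Euc m) ℝ).comp
          (ContinuousLinearMap.fst ℝ (Euc m) ℝ)‖ ≤ 1 := by
        refine ContinuousLinearMap.opNorm_le_bound _ zero_le_one fun z => ?_
        simpa using norm_fst_le z
      have h1 := hA.comp_affine (isOpen_modelSet m ξ) (U := modelSet m (ξ - 1)) _ hnorm
        ((0, r₀ - a) : ModelSpace m) (fun z hz => by simpa using ht₀ z hz)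
      simpa using h1
    obtain ⟨hρ, hρ'⟩ := c2BoundedOn_cutoff hB hρW.smooth hρW.mem_Icc hρB
    have hcomp : ∀ f : ℝ → ℝ, C2BoundedOn Set.univ f B →
        C2BoundedOn (modelSet m (ξ - 1)) (fun z => f (z.2 + a - r₀)) B := fun f hf =>
      (hf.comp_smul_snd (U := modelSet m (ξ - 1)) (s := 1) isOpen_univ (by simp) (a - r₀)
        (fun z _ => Set.mem_univ _)).congr hU fun z _ => by ring_nf
    have hω := hcomp _ hρ
    have hω' := hcomp _ hρ'
    have hF := c2BoundedOn_sinh_ratio (m := m) hξ (by linarith : 1 ≤ r₀) (by linarith) hnear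
    have hD := c2BoundedOn_sinh_ratio_sub_exp (m := m) (a := a) hξ (by linarith : 1 ≤ r₀)
      (b := r₀ - d) (by linarith) (by linarith) (by linarith)
    have hD' := (hω'.mul hU hD).const_mul hU (inner ℝ v.1 w.1)
    -- The error is `(1-ρ)·ratio·A(x, r₀-a) + ρ·A` plus `(1-ρ)` times the purely hyperbolic
    -- discrepancy. The first two give `4·4·34 + 4 = 548`, the last one `4·28 = 112`.
    have hsum := ((hω'.mul hU (hF.mul hU hA₀)).add hU (hω.mul hU (hA.mono_set hsub))).add hU hD'
    refine (hsum.mono ?_).congr hU fun z hz => ?_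
    · have h1 := abs_inner_modelBasis_le i j
      have h2 : |inner ℝ v.1 w.1| * (4 * B * (28 * Real.exp (2 * ξ) * Real.exp (-(r₀ - d)))) ≤
          1 * (4 * B * (28 * Real.exp (2 * ξ) * Real.exp (-(r₀ - d)))) := by gcongr
      have h3 : 4 * B * ε ≤ 4 * B * Real.exp (4 * ξ) * ε := by
        have := mul_le_mul_of_nonneg_left h4 (by positivity : 0 ≤ 4 * B * ε)
        linarith
      linarith
    · have h1 := hG.pullback_eq h (ht₀ z hz) v w
      have h2 : G (r₀ • φ₁ z.1) (r₀ • fderiv ℝ φ₁ z.1 v.1) (r₀ • fderiv ℝ φ₁ z.1 w.1) =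
          A (z.1, r₀ - a) + Real.exp (2 * (r₀ - a)) * inner ℝ v.1 w.1 := by
        simp only [hAdef, h1, modelMetric, sub_add_cancel]; ring
      rw [hform z hz, h2, modelMetric]
      ring

end WarpForcing

/-! ### Uniform positivity and normalization of matrices. -/

section CoordForm

open Matrix
open scoped MatrixOrder

variable {m : ℕ}

/-- The bilinear form with matrix `h`. -/
noncomputable def coordForm (h : Matrix (Fin m) (Fin m) ℝ) (v w : Euc m) : ℝ :=
  ∑ p, ∑ q, v p * w q * h p q

theorem coordForm_eq_dotProduct (h : Matrix (Fin m) (Fin m) ℝ) (v w : Euc m) :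
    coordForm h v w = v.ofLp ⬝ᵥ (h *ᵥ w.ofLp) := by
  simp only [coordForm, dotProduct, mulVec, Finset.mul_sum]
  exact Finset.sum_congr rfl fun p _ => Finset.sum_congr rfl fun q _ => by ring

theorem coordForm_add_smul (h k : Matrix (Fin m) (Fin m) ℝ) (a b : ℝ) (v w : Euc m) :
    coordForm (a • h + b • k) v w = a * coordForm h v w + b * coordForm k v w := by
  simp only [coordForm, Finset.mul_sum, ← Finset.sum_add_distrib, Matrix.add_apply,
    Matrix.smul_apply, smul_eq_mul]
  exact Finset.sum_congr rfl fun p _ => Finset.sum_congr rfl fun q _ => by ring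

theorem coordForm_smul_smul (h : Matrix (Fin m) (Fin m) ℝ) (a b : ℝ) (v w : Euc m) :
    coordForm h (a • v) (b • w) = a * b * coordForm h v w := by
  simp only [coordForm, Finset.mul_sum, PiLp.smul_apply, smul_eq_mul]
  exact Finset.sum_congr rfl fun p _ => Finset.sum_congr rfl fun q _ => by ring

/-- A bilinear form in terms of its components. -/
theorem coordForm_of_bilinear {E : Type*} [NormedAddCommGroup E] [NormedSpace ℝ E]
    (b : E →L[ℝ] E →L[ℝ] ℝ) (T : Euc m →L[ℝ] E) (v w : Euc m) :
    coordForm (Matrix.of fun p q => b (T (EuclideanSpace.single p 1))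
      (T (EuclideanSpace.single q 1))) v w = b (T v) (T w) := by
  have hv : ∀ v : Euc m, v = ∑ p, v p • EuclideanSpace.single p (1 : ℝ) := fun v => by
    ext i
    simp [Finset.sum_apply, Pi.single_apply]
  conv_rhs => rw [hv v, hv w]
  simp only [map_sum, map_smul, _root_.sum_apply, _root_.smul_apply, coordForm, smul_eq_mul,
    Finset.mul_sum, Matrix.of_apply]
  rw [Finset.sum_comm]
  exact Finset.sum_congr rfl fun p _ => Finset.sum_congr rfl fun q _ => by ring

theorem C2BoundedOn.coordForm {E : Type*} [NormedAddCommGroup E] [NormedSpace ℝ E] {U : Set E}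
    (hU : IsOpen U) {N : E → Matrix (Fin m) (Fin m) ℝ} {K : ℝ} (hK : 0 ≤ K)
    (h : ∀ p q, C2BoundedOn U (fun z => N z p q) K) {v w : Euc m} {β : ℝ} (hv : ‖v‖ ≤ β)
    (hw : ‖w‖ ≤ β) :
    C2BoundedOn U (fun z => _root_.coordForm (N z) v w) (m ^ 2 * β ^ 2 * K) := by
  have h1 := C2BoundedOn.sum hU Finset.univ fun p (_ : p ∈ Finset.univ) =>
    C2BoundedOn.sum hU Finset.univ fun q (_ : q ∈ Finset.univ) => (h p q).const_mul hU (v p * w q)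
  refine h1.mono ?_
  have hβ : 0 ≤ β := (norm_nonneg v).trans hv
  have h2 : ∀ p q, |v p * w q| * K ≤ β ^ 2 * K := fun p q => by
    have h3 := (PiLp.norm_apply_le v p).trans hv
    have h4 := (PiLp.norm_apply_le w q).trans hw
    rw [Real.norm_eq_abs] at h3 h4
    rw [abs_mul, sq]
    gcongr
  calc _ ≤ ∑ _p : Fin m, ∑ _q : Fin m, β ^ 2 * K :=
        Finset.sum_le_sum fun p _ => Finset.sum_le_sum fun q _ => h2 p q
    _ = m ^ 2 * β ^ 2 * K := by simp; ring

theorem posDef_of_coordForm {h : Matrix (Fin m) (Fin m) ℝ} (hs : ∀ p q, h p q = h q p)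
    (hn : ∀ v, 0 ≤ coordForm h v v) (hd : h.det ≠ 0) : h.PosDef := by
  have h1 : h.IsHermitian := by
    ext p q; simp [hs p q]
  refine (PosSemidef.of_dotProduct_mulVec_nonneg h1 fun x => ?_).posDef_iff_det_ne_zero.2 hd
  have := hn (WithLp.toLp 2 x)
  rw [coordForm_eq_dotProduct] at this
  simpa using this

/-- Uniform positivity of nonnegative matrices with bounded entries and determinant bounded away
from zero. -/
theorem exists_coordForm_lower_bound (m : ℕ) (c : ℝ) {κ : ℝ} (hκ : 0 < κ) :
    ∃ lam > 0, ∀ h : Matrix (Fin m) (Fin m) ℝ, (∀ p q, h p q = h q p) →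
      (∀ v, 0 ≤ coordForm h v v) → (∀ p q, |h p q| ≤ c) → κ ≤ |h.det| →
      ∀ v, lam * ‖v‖ ^ 2 ≤ coordForm h v v := by
  let 𝒦 : Set (Matrix (Fin m) (Fin m) ℝ) := {h | (∀ p q, |h p q| ≤ c)}
  let 𝒞 : Set (Matrix (Fin m) (Fin m) ℝ) :=
    {h | (∀ p q, h p q = h q p) ∧ (∀ v, 0 ≤ coordForm h v v) ∧ κ ≤ |h.det|}
  have hcont : Continuous fun x : Matrix (Fin m) (Fin m) ℝ × Euc m => coordForm x.1 x.2 x.2 := by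
    unfold coordForm
    refine continuous_finsetSum _ fun p _ => continuous_finsetSum _ fun q _ => ?_
    refine Continuous.mul (by fun_prop) ?_
    exact continuous_fst.matrix_elem p q
  have h𝒦 : IsCompact 𝒦 := by
    have h1 : 𝒦 = (Set.pi Set.univ fun _ : Fin m => Set.pi Set.univ
        fun _ : Fin m => Set.Icc (-c) c) := Set.ext fun h =>
      ⟨fun H p _ q _ => abs_le.1 (H p q), fun H p q => abs_le.2 (H p trivial q trivial)⟩
    rw [h1]
    exact isCompact_univ_pi fun _ => isCompact_univ_pi fun _ => isCompact_Icc
  have h𝒞 : IsClosed 𝒞 := by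
    have h1 : IsClosed {h : Matrix (Fin m) (Fin m) ℝ | ∀ p q, h p q = h q p} := by
      simp only [Set.ofPred_forall]
      exact isClosed_iInter fun p => isClosed_iInter fun q =>
        isClosed_eq (continuous_id.matrix_elem p q) (continuous_id.matrix_elem q p)
    have h2 : IsClosed {h : Matrix (Fin m) (Fin m) ℝ | ∀ v, 0 ≤ coordForm h v v} := by
      simp only [Set.ofPred_forall]
      exact isClosed_iInter fun v => isClosed_le continuous_const
        (hcont.comp (continuous_id.prodMk continuous_const))
    have h3 : IsClosed {h : Matrix (Fin m) (Fin m) ℝ | κ ≤ |h.det|} :=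
      isClosed_le continuous_const (continuous_id.matrix_det.abs)
    exact h1.inter (h2.inter h3)
  -- The set of admissible matrices times the unit sphere is compact, and the form is positive on it
  -- because a semidefinite matrix with nonzero determinant is definite. Asking only for a positive
  -- lower bound also covers `m = 0`, where the sphere is empty.
  obtain ⟨lam, hlam, H⟩ := ((h𝒦.inter_right h𝒞).prod
    (isCompact_sphere (0 : Euc m) 1)).exists_forall_le' hcont.continuousOn (a := 0) (by
      rintro ⟨h, v⟩ ⟨⟨-, hs, hn, hd⟩, hv⟩
      have hv0 : v ≠ 0 := by
        rintro rfl; simp at hv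
      have hd' : h.det ≠ 0 := by
        intro h0
        rw [h0, abs_zero] at hd
        linarith
      have := (posDef_of_coordForm hs hn hd').dotProduct_mulVec_pos (x := v.ofLp) (by simpa using hv0)
      simpa [coordForm_eq_dotProduct] using this)
  refine ⟨lam, hlam, fun h hs hn hc hd v => ?_⟩
  rcases eq_or_ne v 0 with rfl | hv
  · simpa using hn 0
  · have hv' : ‖v‖ ≠ 0 := norm_ne_zero_iff.2 hv
    have h1 := H (h, ‖v‖⁻¹ • v) ⟨⟨hc, hs, hn, hd⟩, by simp [norm_smul, hv']⟩
    simp only [coordForm_smul_smul] at h1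
    have h2 : ‖v‖ ^ 2 * lam ≤ ‖v‖ ^ 2 * (‖v‖⁻¹ * ‖v‖⁻¹ * coordForm h v v) := by gcongr
    calc lam * ‖v‖ ^ 2 ≤ ‖v‖ ^ 2 * (‖v‖⁻¹ * ‖v‖⁻¹ * coordForm h v v) := by linarith
      _ = coordForm h v v := by field_simp

/-- A linear map that pulls a positive definite form back to the inner product. -/
theorem exists_orthonormalizing_map {h : Matrix (Fin m) (Fin m) ℝ} (hs : ∀ p q, h p q = h q p)
    {lam : ℝ} (hlam : 0 < lam) (hl : ∀ v, lam * ‖v‖ ^ 2 ≤ coordForm h v v) :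
    ∃ T : Euc m →L[ℝ] Euc m, ‖T‖ ≤ (Real.sqrt lam)⁻¹ ∧
      ∀ v w, coordForm h (T v) (T w) = inner ℝ v w := by
  have hpd : h.PosDef := by
    refine .of_dotProduct_mulVec_pos (by ext p q; simp [hs p q]) fun x hx => ?_
    have h1 := hl (WithLp.toLp 2 x)
    rw [coordForm_eq_dotProduct] at h1
    have h2 : 0 < ‖WithLp.toLp 2 x‖ := norm_pos_iff.2 (by simpa using hx)
    have : 0 < lam * ‖WithLp.toLp 2 x‖ ^ 2 := by positivity
    simpa using this.trans_le h1
  -- Writing `h = Bᵀ B`, the map is `B⁻¹`. Its norm bound follows from `lam ‖B⁻¹v‖² ≤ h(B⁻¹v, B⁻¹v)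
  -- = ‖v‖²`.
  obtain ⟨B, hB⟩ := CStarAlgebra.nonneg_iff_eq_star_mul_self.1 hpd.posSemidef.nonneg
  have hBu : IsUnit B.det := by
    have h1 := hpd.det_pos
    rw [hB, det_mul] at h1
    exact isUnit_iff_ne_zero.2 (right_ne_zero_of_mul h1.ne')
  have key : ∀ v w : Euc m, coordForm h (toEuclideanCLM (𝕜 := ℝ) B⁻¹ v)
      (toEuclideanCLM (𝕜 := ℝ) B⁻¹ w) = inner ℝ v w := by
    intro v w
    rw [coordForm_eq_dotProduct, hB, ofLp_toEuclideanCLM, ofLp_toEuclideanCLM, mulVec_mulVec,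
      Matrix.mul_assoc, mul_nonsing_inv _ hBu, Matrix.mul_one, star_eq_conjTranspose,
      conjTranspose_eq_transpose_of_trivial, mulVec_transpose, dotProduct_comm, ← dotProduct_mulVec,
      mulVec_mulVec, mul_nonsing_inv _ hBu, one_mulVec, dotProduct_comm]
    simp [PiLp.inner_apply, dotProduct, mul_comm]
  refine ⟨toEuclideanCLM (𝕜 := ℝ) B⁻¹, ?_, key⟩
  refine ContinuousLinearMap.opNorm_le_bound _ (by positivity) fun v => ?_
  have h1 := hl (toEuclideanCLM (𝕜 := ℝ) B⁻¹ v)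
  rw [key, real_inner_self_eq_norm_sq] at h1
  have hsq := Real.sqrt_pos.2 hlam
  rw [inv_mul_eq_div, le_div_iff₀ hsq]
  refine le_of_sq_le_sq ?_ (norm_nonneg _)
  rw [mul_pow, Real.sq_sqrt hlam.le]
  linarith

end CoordForm

/-! ### Uniform constants of the sphere atlas. -/

theorem exists_c2BoundedOn_of_isCompact_closure {E : Type*} [NormedAddCommGroup E] [NormedSpace ℝ E]
    {U W : Set E} {f : E → ℝ} (hW : IsOpen W) (hf : ContDiffOn ℝ ∞ f W)
    (hc : IsCompact (closure U)) (hUW : closure U ⊆ W) : ∃ K, C2BoundedOn U f K := by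
  have h1 : ∀ k : Fin 3, ∃ K, ∀ z ∈ closure U, ‖iteratedFDeriv ℝ (k : ℕ) f z‖ ≤ K := by
    intro k
    refine hc.exists_bound_of_continuousOn (ContinuousOn.mono ?_ hUW)
    have h2 := hf.continuousOn_iteratedFDerivWithin (m := (k : ℕ)) (by exact_mod_cast le_top)
      hW.uniqueDiffOn
    exact h2.congr fun z hz => (iteratedFDerivWithin_of_isOpen _ hW hz).symm
  choose K hK using h1
  obtain ⟨K', hK'⟩ := (Set.finite_range K).bddAbove
  exact ⟨K', contDiffOn_infty.1 (hf.mono (subset_closure.trans hUW)) 2, fun k hk z hz =>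
    (hK ⟨k, by omega⟩ z (subset_closure hz)).trans (hK' ⟨_, rfl⟩)⟩

namespace SphereAtlas

variable {m : ℕ} (𝒜 : SphereAtlas m)

theorem differentiableAt (i : Fin 𝒜.card) {x : Euc m} (hx : x ∈ 𝒜.W i) :
    DifferentiableAt ℝ (𝒜.param i) x :=
  ((𝒜.smooth i).contDiffAt ((𝒜.isOpen_W i).mem_nhds hx)).differentiableAt (by simp)

theorem U_subset_W (i : Fin 𝒜.card) : 𝒜.U i ⊆ 𝒜.W i :=
  subset_closure.trans (𝒜.closure_subset i)

/-- A Lebesgue number of the atlas. -/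
theorem exists_ball_subset :
    ∃ s > 0, ∀ u : Euc (m + 1), ‖u‖ = 1 → ∃ i x, 𝒜.param i x = u ∧ Metric.ball x s ⊆ 𝒜.U i := by
  suffices h : ∃ s > 0, ∀ u ∈ Metric.sphere (0 : Euc (m + 1)) 1,
      ∃ i x, 𝒜.param i x = u ∧ Metric.ball x s ⊆ 𝒜.U i by
    simpa using h
  refine (isCompact_sphere (0 : Euc (m + 1)) 1).induction_on
    (p := fun t => ∃ s > 0, ∀ u ∈ t, ∃ i x, 𝒜.param i x = u ∧ Metric.ball x s ⊆ 𝒜.U i)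
    ⟨1, one_pos, by simp⟩ ?_ ?_ ?_
  · rintro s t hst ⟨r, hr, H⟩
    exact ⟨r, hr, fun u hu => H u (hst hu)⟩
  · rintro s t ⟨r, hr, H⟩ ⟨r', hr', H'⟩
    refine ⟨min r r', lt_min hr hr', ?_⟩
    rintro u (hu | hu)
    · obtain ⟨i, x, hx, hb⟩ := H u hu
      exact ⟨i, x, hx, (Metric.ball_subset_ball (min_le_left _ _)).trans hb⟩
    · obtain ⟨i, x, hx, hb⟩ := H' u hu
      exact ⟨i, x, hx, (Metric.ball_subset_ball (min_le_right _ _)).trans hb⟩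
  · intro u hu
    have hu1 : ‖u‖ = 1 := by simpa using hu
    obtain ⟨i, x, hx, hxu⟩ := 𝒜.covers u hu1
    have hxW := 𝒜.U_subset_W i hx
    obtain ⟨r, hr, hrU⟩ := Metric.isOpen_iff.1 (𝒜.isOpen_U i) x hx
    -- Coning off the parametrization gives a map between spaces of equal dimension with invertible
    -- differential at `(x, 1)`. It is therefore open there, which makes the image of a small ball a
    -- neighbourhood of `u` in the sphere.
    let ψ : Euc m × ℝ → Euc (m + 1) := fun z => z.2 • 𝒜.param i z.1
    have hψ : HasStrictFDerivAt ψ (fderiv ℝ ψ (x, 1)) (x, 1) := by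
      have h1 : ContDiffAt ℝ ∞ (fun z : Euc m × ℝ => 𝒜.param i z.1) (x, 1) :=
        ((𝒜.smooth i).contDiffAt ((𝒜.isOpen_W i).mem_nhds hxW)).comp (x, (1 : ℝ)) contDiffAt_fst
      have h2 : ContDiffAt ℝ ∞ ψ (x, 1) := contDiffAt_snd.smul h1
      exact h2.hasStrictFDerivAt (by simp)
    have hder : ∀ v : Euc m × ℝ, fderiv ℝ ψ (x, 1) v = v.2 • u + fderiv ℝ (𝒜.param i) x v.1 := by
      intro v
      have h3 : HasFDerivAt (fun z : Euc m × ℝ => 𝒜.param i z.1)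
          ((fderiv ℝ (𝒜.param i) x).comp (ContinuousLinearMap.fst ℝ (Euc m) ℝ)) (x, 1) :=
        HasFDerivAt.comp (x, (1 : ℝ)) (𝒜.differentiableAt i hxW).hasFDerivAt hasFDerivAt_fst
      have h4 : HasFDerivAt ψ _ (x, 1) := (hasFDerivAt_snd (𝕜 := ℝ) (E := Euc m)).smul h3
      rw [h4.fderiv]
      simp [hxu, add_comm]
    have hinj : Function.Injective (fderiv ℝ ψ (x, 1) : Euc m × ℝ →ₗ[ℝ] Euc (m + 1)) := by
      rw [← LinearMap.ker_eq_bot, LinearMap.ker_eq_bot']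
      intro v hv
      have h1 : v.2 • u + fderiv ℝ (𝒜.param i) x v.1 = 0 := by rw [← hder]; exact hv
      have h2 := inner_fderiv_of_norm_eq_one (𝒜.isOpen_W i) (𝒜.norm_param i) hxW
        (𝒜.differentiableAt i hxW) v.1
      rw [hxu] at h2
      have h3 := congrArg (fun y => inner ℝ u y) h1
      simp only [inner_add_right, inner_smul_right, h2, real_inner_self_eq_norm_sq, hu1,
        inner_zero_right] at h3
      have h4 : v.2 = 0 := by linarith
      rw [h4, zero_smul, zero_add] at h1
      have h5 : v.1 = 0 := 𝒜.immersion i x hxW (by rw [h1, map_zero])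
      exact Prod.ext h5 h4
    have hsurj : (fderiv ℝ ψ (x, 1)).range = ⊤ := by
      rw [LinearMap.range_eq_top]
      exact (LinearMap.injective_iff_surjective_of_finrank_eq_finrank (by simp)).1 hinj
    have hmap := hψ.map_nhds_eq_of_surj hsurj
    have hψu : ψ (x, 1) = u := by simp [ψ, hxu]
    rw [hψu] at hmap
    have hball : Metric.ball x (r / 2) ×ˢ Set.Ioi (0 : ℝ) ∈ nhds (x, (1 : ℝ)) :=
      prod_mem_nhds (Metric.ball_mem_nhds _ (by linarith)) (Ioi_mem_nhds one_pos)
    refine ⟨ψ '' (Metric.ball x (r / 2) ×ˢ Set.Ioi (0 : ℝ)) ∩ Metric.sphere 0 1,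
      Filter.inter_mem (mem_nhdsWithin_of_mem_nhds (hmap ▸ Filter.image_mem_map hball))
        self_mem_nhdsWithin, r / 2, by linarith, ?_⟩
    -- A unit vector in the image has `τ = 1`; halving the radius leaves room for a ball around the
    -- new center `y`.
    rintro _ ⟨⟨⟨y, τ⟩, ⟨hy, hτ⟩, rfl⟩, hs⟩
    simp only at hy hτ
    have hyU : Metric.ball y (r / 2) ⊆ 𝒜.U i := by
      refine (Metric.ball_subset_ball' ?_).trans hrU
      have := Metric.mem_ball.1 hy
      linarith
    have hyW : y ∈ 𝒜.W i := 𝒜.U_subset_W i (hyU (Metric.mem_ball_self (by linarith)))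
    have h1 : ‖ψ (y, τ)‖ = 1 := by simpa using hs
    simp only [ψ, norm_smul, 𝒜.norm_param i y hyW, mul_one, Real.norm_eq_abs,
      abs_of_pos (show 0 < τ from hτ)] at h1
    exact ⟨i, y, by simp [ψ, h1], hyU⟩

theorem coordForm_matrix_round (i : Fin 𝒜.card) (x v w : Euc m) :
    coordForm (𝒜.matrix (roundMetric (m + 1)) i x) v w =
      inner ℝ (fderiv ℝ (𝒜.param i) x v) (fderiv ℝ (𝒜.param i) x w) :=
  coordForm_of_bilinear (innerSL ℝ) (fderiv ℝ (𝒜.param i) x) v w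

theorem coordForm_matrix_sphericalCut (G : Euc (m + 1) → Euc (m + 1) →L[ℝ] Euc (m + 1) →L[ℝ] ℝ)
    (r₀ : ℝ) (i : Fin 𝒜.card) (x v w : Euc m) :
    coordForm (𝒜.matrix (sphericalCut (fun y v w => G y v w) r₀) i x) v w =
      sphericalCut (fun y v w => G y v w) r₀ (𝒜.param i x) (fderiv ℝ (𝒜.param i) x v)
        (fderiv ℝ (𝒜.param i) x w) := by
  have h := coordForm_of_bilinear ((1 / Real.sinh r₀ ^ 2 * r₀ ^ 2) • G (r₀ • 𝒜.param i x))
    (fderiv ℝ (𝒜.param i) x) v w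
  have h1 : ∀ v w, sphericalCut (fun y v w => G y v w) r₀ (𝒜.param i x) v w =
      ((1 / Real.sinh r₀ ^ 2 * r₀ ^ 2) • G (r₀ • 𝒜.param i x)) v w := fun v w => by
    simp [sphericalCut, warpedCut]; ring
  simp only [SphereAtlas.matrix, h1]
  exact h

theorem contDiffOn_fderiv (i : Fin 𝒜.card) : ContDiffOn ℝ ∞ (fderiv ℝ (𝒜.param i)) (𝒜.W i) :=
  (𝒜.smooth i).fderiv_of_isOpen (𝒜.isOpen_W i) (by simp)

theorem contDiffOn_matrix_round (i : Fin 𝒜.card) (p q : Fin m) :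
    ContDiffOn ℝ ∞ (fun x => 𝒜.matrix (roundMetric (m + 1)) i x p q) (𝒜.W i) :=
  ((𝒜.contDiffOn_fderiv i).clm_apply contDiffOn_const).inner ℝ
    ((𝒜.contDiffOn_fderiv i).clm_apply contDiffOn_const)

theorem contDiffOn_matrix_sphericalCut
    {G : Euc (m + 1) → Euc (m + 1) →L[ℝ] Euc (m + 1) →L[ℝ] ℝ} (hG : IsRadialForm G)
    (r₀ : ℝ) (i : Fin 𝒜.card) (p q : Fin m) :
    ContDiffOn ℝ ∞ (fun x => 𝒜.matrix (sphericalCut (fun y v w => G y v w) r₀) i x p q)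
      (𝒜.W i) := by
  have h1 := 𝒜.contDiffOn_fderiv i
  have h2 : ∀ p : Fin m, ContDiffOn ℝ ∞
      (fun x => r₀ • fderiv ℝ (𝒜.param i) x (EuclideanSpace.single p 1)) (𝒜.W i) := fun p =>
    (h1.clm_apply contDiffOn_const).const_smul r₀
  exact contDiffOn_const.mul (((hG.smooth.comp_contDiffOn ((𝒜.smooth i).const_smul r₀)).clm_apply
    (h2 p)).clm_apply (h2 q))

/-- The matrix of the round metric is the Gram matrix of an immersion, hence nonsingular on the
compact closure of each chart domain; finiteness of the atlas makes the constants common. -/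
theorem exists_round_bounds :
    ∃ K κ : ℝ, 0 < κ ∧ ∀ i, (∀ p q, C2BoundedOn (𝒜.U i)
      (fun x => 𝒜.matrix (roundMetric (m + 1)) i x p q) K) ∧
      ∀ x ∈ 𝒜.U i, κ ≤ |(𝒜.matrix (roundMetric (m + 1)) i x).det| := by
  have h1 : ∀ z : Fin 𝒜.card × Fin m × Fin m, ∃ K, C2BoundedOn (𝒜.U z.1)
      (fun x => 𝒜.matrix (roundMetric (m + 1)) z.1 x z.2.1 z.2.2) K := fun z =>
    exists_c2BoundedOn_of_isCompact_closure (𝒜.isOpen_W z.1)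
      (𝒜.contDiffOn_matrix_round z.1 z.2.1 z.2.2) (𝒜.isCompact_closure z.1) (𝒜.closure_subset z.1)
  have h2 : ∀ i, ∃ κ, 0 < κ ∧ ∀ x ∈ closure (𝒜.U i),
      κ ≤ |(𝒜.matrix (roundMetric (m + 1)) i x).det| := fun i => by
    refine (𝒜.isCompact_closure i).exists_forall_le' ?_ ?_
    · have h3 : ContinuousOn (fun x => 𝒜.matrix (roundMetric (m + 1)) i x) (𝒜.W i) :=
        continuousOn_pi.2 fun p => continuousOn_pi.2 fun q =>
          (𝒜.contDiffOn_matrix_round i p q).continuousOn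
      exact (continuous_id.matrix_det.abs.comp_continuousOn h3).mono (𝒜.closure_subset i)
    · intro x hx
      refine abs_pos.2 fun hdet => ?_
      obtain ⟨v, hv, h0⟩ := Matrix.exists_mulVec_eq_zero_iff.2 hdet
      have h4 := 𝒜.coordForm_matrix_round i x (WithLp.toLp 2 v) (WithLp.toLp 2 v)
      rw [coordForm_eq_dotProduct] at h4
      simp only [h0, dotProduct_zero] at h4
      have h5 := inner_self_eq_zero.1 h4.symm
      have h6 : WithLp.toLp 2 v = (0 : Euc m) :=
        𝒜.immersion i x (𝒜.closure_subset i hx) (by rw [h5, map_zero])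
      exact hv (by simpa using h6)
  choose K hK using h1
  choose κ hκ0 hκ using h2
  obtain ⟨K', hK'⟩ := (Set.finite_range K).bddAbove
  obtain ⟨κ', hκ'0, hκ'⟩ : ∃ κ' > 0, ∀ i, κ' ≤ κ i := by
    obtain ⟨κ', h, H⟩ := (Set.finite_univ (α := Fin 𝒜.card)).isCompact.exists_forall_le'
      (f := κ) (a := 0) (Continuous.continuousOn (by fun_prop)) (fun i _ => hκ0 i)
    exact ⟨κ', h, fun i => H i trivial⟩
  exact ⟨K', κ', hκ'0, fun i => ⟨fun p q => (hK (i, p, q)).mono (hK' ⟨_, rfl⟩),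
    fun x hx => (hκ' i).trans (hκ i x (subset_closure hx))⟩⟩

end SphereAtlas

/-- The derivatives of a smooth gluing function are bounded. -/
theorem exists_deriv_bound_of_plateaus {ρ : ℝ → ℝ} (hρ : ContDiff ℝ ∞ ρ) {α β : ℝ}
    (h0 : ∀ t ≤ α, ρ t = 0) (h1 : ∀ t, β ≤ t → ρ t = 1) :
    ∃ B, 1 ≤ B ∧ ∀ t, |deriv ρ t| ≤ B ∧ |deriv (deriv ρ) t| ≤ B := by
  have hd1 : ContDiff ℝ ∞ (deriv ρ) := (contDiff_infty_iff_deriv.1 hρ).2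
  have hd2 : ContDiff ℝ ∞ (deriv (deriv ρ)) := (contDiff_infty_iff_deriv.1 hd1).2
  obtain ⟨B₁, hB₁⟩ := (isCompact_Icc (a := α) (b := β)).exists_bound_of_continuousOn
    hd1.continuous.continuousOn
  obtain ⟨B₂, hB₂⟩ := (isCompact_Icc (a := α) (b := β)).exists_bound_of_continuousOn
    hd2.continuous.continuousOn
  have hout : ∀ (c : ℝ) (U : Set ℝ), IsOpen U → (∀ t ∈ U, ρ t = c) → ∀ t ∈ U,
      deriv ρ t = 0 ∧ deriv (deriv ρ) t = 0 := by
    intro c U hU hc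
    have h2 : ∀ t ∈ U, deriv ρ t = 0 := fun t ht => by
      have : ρ =ᶠ[nhds t] fun _ => c := Filter.eventuallyEq_of_mem (hU.mem_nhds ht) hc
      rw [this.deriv_eq, deriv_const]
    refine fun t ht => ⟨h2 t ht, ?_⟩
    have : deriv ρ =ᶠ[nhds t] fun _ => 0 := Filter.eventuallyEq_of_mem (hU.mem_nhds ht) h2
    rw [this.deriv_eq, deriv_const]
  refine ⟨max 1 (max B₁ B₂), le_max_left _ _, fun t => ?_⟩
  by_cases ht : t ∈ Set.Icc α β
  · exact ⟨(hB₁ t ht).trans (by simp), (hB₂ t ht).trans (by simp)⟩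
  · have h3 : deriv ρ t = 0 ∧ deriv (deriv ρ) t = 0 := by
      by_cases hα : t < α
      · exact hout 0 (Set.Iio α) isOpen_Iio (fun t ht => h0 t (le_of_lt ht)) t hα
      · have hβ : β < t := by
          by_contra hβ
          exact ht ⟨not_lt.1 hα, not_lt.1 hβ⟩
        exact hout 1 (Set.Ioi β) isOpen_Ioi (fun t ht => h1 t (le_of_lt ht)) t hβ
    simp [h3.1, h3.2]

theorem IsPolarMap.isRadialChart {m : ℕ} {ξ : ℝ} {φ : ModelSpace m → Euc (m + 1)}
    {φ₁ : Euc m → Euc (m + 1)} {a : ℝ} (h : IsPolarMap ξ φ φ₁ a)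
    (hinj : Set.InjOn φ₁ (Metric.ball 0 1))
    (himm : ∀ x ∈ Metric.ball (0 : Euc m) 1, Function.Injective (fderiv ℝ φ₁ x)) :
    IsRadialChart ξ φ := by
  refine ⟨h.contDiffOn, fun z hz z' hz' hzz => ?_, fun z hz => ?_, φ₁, a, fun z hz =>
    ⟨h.norm_eq _ hz.1, h.pos _ hz.2, h.eq z hz⟩⟩
  · have h1 : z.2 = z'.2 := by
      have := congrArg norm hzz
      rw [h.norm_map hz, h.norm_map hz'] at this
      linarith
    rw [h.eq z hz, h.eq z' hz', ← h1] at hzz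
    exact Prod.ext (hinj hz.1 hz'.1 (smul_right_injective _ (h.pos _ hz.2).ne' hzz)) h1
  · rw [injective_iff_map_eq_zero]
    intro v hv
    have h1 := hv
    rw [h.fderiv_apply hz] at h1
    have h3 := congrArg (fun y => inner ℝ (φ₁ z.1) y) h1
    simp only [inner_add_right, inner_smul_right, h.inner_fderiv hz.1, real_inner_self_eq_norm_sq,
      h.norm_eq _ hz.1, inner_zero_right] at h3
    have h4 : v.2 = 0 := by linarith
    rw [h4, zero_smul, zero_add] at h1
    have h5 := (smul_eq_zero.1 h1).resolve_left (h.pos _ hz.2).ne'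
    exact Prod.ext (himm _ hz.1 (by rw [h5, Prod.fst_zero, map_zero])) h4

/-! ### Charts obtained from the atlas by affine reparametrization. -/

namespace SphereAtlas

variable {m : ℕ} (𝒜 : SphereAtlas m) {ξ a s : ℝ} {k : Fin 𝒜.card} {x₀ : Euc m}
  {L : Euc m →L[ℝ] Euc m}

theorem add_apply_mem (hball : Metric.ball x₀ s ⊆ 𝒜.U k) (hL : ‖L‖ ≤ s) (hs : 0 < s)
    {x : Euc m} (hx : x ∈ Metric.ball (0 : Euc m) 1) : x₀ + L x ∈ 𝒜.U k := by
  refine hball ?_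
  rw [Metric.mem_ball, dist_self_add_left]
  have hx' : ‖x‖ < 1 := by simpa using hx
  calc ‖L x‖ ≤ s * ‖x‖ := L.le_of_opNorm_le hL x
    _ < s * 1 := by gcongr
    _ = s := mul_one s

theorem fderiv_param_affine {x : Euc m} (hx : x₀ + L x ∈ 𝒜.U k) (v : Euc m) :
    fderiv ℝ (fun x => 𝒜.param k (x₀ + L x)) x v = fderiv ℝ (𝒜.param k) (x₀ + L x) (L v) := by
  have h1 : HasFDerivAt (fun x => x₀ + L x) L x := L.hasFDerivAt.const_add x₀
  have h2 : HasFDerivAt (fun x => 𝒜.param k (x₀ + L x)) _ x :=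
    (𝒜.differentiableAt k (𝒜.U_subset_W k hx)).hasFDerivAt.comp x h1
  rw [h2.fderiv]
  rfl

theorem isPolarMap_affine (hball : Metric.ball x₀ s ⊆ 𝒜.U k) (hL : ‖L‖ ≤ s) (hs : 0 < s)
    (ha : 1 + ξ ≤ a) :
    IsPolarMap ξ (fun z : ModelSpace m => (z.2 + a) • 𝒜.param k (x₀ + L z.1))
      (fun x => 𝒜.param k (x₀ + L x)) a := by
  have hW : ∀ x ∈ Metric.ball (0 : Euc m) 1, x₀ + L x ∈ 𝒜.W k := fun x hx =>
    𝒜.U_subset_W k (𝒜.add_apply_mem hball hL hs hx)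
  refine ⟨(𝒜.smooth k).comp (contDiff_const.add L.contDiff).contDiffOn hW,
    fun x hx => 𝒜.norm_param k _ (hW x hx), fun t ht => ?_, fun z _ => rfl⟩
  linarith [ht.1]

theorem isRadialChart_affine (hball : Metric.ball x₀ s ⊆ 𝒜.U k) (hL : ‖L‖ ≤ s) (hs : 0 < s)
    (hLi : Function.Injective L) (ha : 1 + ξ ≤ a) :
    IsRadialChart ξ (fun z : ModelSpace m => (z.2 + a) • 𝒜.param k (x₀ + L z.1)) := by
  have hU : ∀ x ∈ Metric.ball (0 : Euc m) 1, x₀ + L x ∈ 𝒜.U k := fun x hx =>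
    𝒜.add_apply_mem hball hL hs hx
  refine (𝒜.isPolarMap_affine hball hL hs ha).isRadialChart (fun x hx y hy hxy => ?_)
    fun x hx v w hvw => ?_
  · exact hLi (add_left_cancel (𝒜.injOn k (𝒜.U_subset_W k (hU x hx))
      (𝒜.U_subset_W k (hU y hy)) hxy))
  · rw [𝒜.fderiv_param_affine (hU x hx), 𝒜.fderiv_param_affine (hU x hx)] at hvw
    exact hLi (𝒜.immersion k _ (𝒜.U_subset_W k (hU x hx)) hvw)

/-- The interpolation between the matrices of the round metric and of `h`. -/
noncomputable def interpMatrix (ρ : ℝ → ℝ) (h : TensorField (m + 1)) (k : Fin 𝒜.card)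
    (z : ModelSpace m) : Matrix (Fin m) (Fin m) ℝ :=
  (1 - ρ z.2) • 𝒜.matrix (roundMetric (m + 1)) k z.1 + ρ z.2 • 𝒜.matrix h k z.1

/-- The condition `a + (1 + ξ) ≤ r₀` keeps the chart where warp forcing replaces `g_r` by the
rescaled cut. The spherical part then depends on `z` through one fixed matrix function composed with
an affine map of linear part `L × (2/d)`, the form to which `comp_affine_sub_const` applies. -/
theorem pullback_hypForce_affine {G : Euc (m + 1) → Euc (m + 1) →L[ℝ] Euc (m + 1) →L[ℝ] ℝ}
    (hG : IsRadialForm G) (ρT : ℝ → ℝ) {ρW : ℝ → ℝ} (hρW : ∀ t ≤ 0, ρW t = 0) {r₀ : ℝ} (d : ℝ)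
    (hball : Metric.ball x₀ s ⊆ 𝒜.U k) (hL : ‖L‖ ≤ s) (hs : 0 < s) (ha : 1 + ξ ≤ a)
    (har : a + (1 + ξ) ≤ r₀) {z : ModelSpace m} (hz : z ∈ modelSet m ξ) (v w : ModelSpace m) :
    pullbackModel (fun z : ModelSpace m => (z.2 + a) • 𝒜.param k (x₀ + L z.1))
      (hypForce ρT ρW r₀ d fun y v w => G y v w) z v w =
    Real.sinh (z.2 + a) ^ 2 * coordForm (𝒜.interpMatrix ρT (sphericalCut (fun y v w => G y v w) r₀) k
      ((x₀, 2 * ((a - (r₀ - d)) / d)) + (L.prodMap ((2 / d) • ContinuousLinearMap.id ℝ ℝ)) z))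
      (L v.1) (L w.1) + v.2 * w.2 := by
  rw [hG.pullback_hypForce ρT ρW r₀ d (𝒜.isPolarMap_affine hball hL hs ha) hz]
  have h1 : ρW (z.2 + a - r₀) = 0 := hρW _ (by linarith [hz.2.2])
  have h2 : ((x₀, 2 * ((a - (r₀ - d)) / d)) : ModelSpace m) +
      (L.prodMap ((2 / d) • ContinuousLinearMap.id ℝ ℝ)) z =
      (x₀ + L z.1, 2 * ((z.2 + a - (r₀ - d)) / d)) := by
    refine Prod.ext rfl ?_
    change 2 * ((a - (r₀ - d)) / d) + 2 / d * z.2 = _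
    ring
  have hU := 𝒜.add_apply_mem hball hL hs hz.1
  simp only [h2, forcedCut, h1, interpMatrix, coordForm_add_smul, coordForm_matrix_round,
    coordForm_matrix_sphericalCut, 𝒜.fderiv_param_affine hU]
  ring

/-- In the rescaled radial variable the bound does not involve `d` or `r₀`; all smallness is left to
the affine map. -/
theorem c2BoundedOn_interpMatrix {ρ : ℝ → ℝ} {B K c : ℝ} (hB : 1 ≤ B) (hρ : ContDiff ℝ ∞ ρ)
    (h01 : ∀ t, ρ t ∈ Set.Icc (0 : ℝ) 1)
    (hρB : ∀ t, |deriv ρ t| ≤ B ∧ |deriv (deriv ρ) t| ≤ B) {h : TensorField (m + 1)}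
    (hK : ∀ p q, C2BoundedOn (𝒜.U k) (fun x => 𝒜.matrix (roundMetric (m + 1)) k x p q) K)
    (hc : ∀ p q, C2BoundedOn (𝒜.U k) (fun x => 𝒜.matrix h k x p q) c) (p q : Fin m) :
    C2BoundedOn (𝒜.U k ×ˢ (Set.univ : Set ℝ)) (fun z => 𝒜.interpMatrix ρ h k z p q)
      (4 * B * K + 4 * B * c) := by
  have hV : IsOpen (𝒜.U k ×ˢ (Set.univ : Set ℝ)) := (𝒜.isOpen_U k).prod isOpen_univ
  obtain ⟨h1, h2⟩ := c2BoundedOn_cutoff hB hρ h01 hρB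
  have hsnd : ∀ f : ℝ → ℝ, C2BoundedOn Set.univ f B →
      C2BoundedOn (𝒜.U k ×ˢ (Set.univ : Set ℝ)) (fun z : ModelSpace m => f z.2) B := fun f hf =>
    (hf.comp_smul_snd (s := 1) isOpen_univ (by simp) 0 (fun z _ => Set.mem_univ _)).congr hV
      fun z _ => by simp
  have hfst : ∀ (f : Euc m → ℝ) (K : ℝ), C2BoundedOn (𝒜.U k) f K →
      C2BoundedOn (𝒜.U k ×ˢ (Set.univ : Set ℝ)) (fun z : ModelSpace m => f z.1) K := fun f K hf =>
    (hf.comp_affine (𝒜.isOpen_U k) (ContinuousLinearMap.fst ℝ (Euc m) ℝ)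
      (ContinuousLinearMap.norm_fst_le _ _ _) 0 (fun z hz => by simpa using hz.1)).congr hV
      fun z _ => by simp
  exact ((hsnd _ h2).mul hV (hfst _ _ (hK p q))).add hV ((hsnd _ h1).mul hV (hfst _ _ (hc p q)))

end SphereAtlas

/-! ### Comparison of warped metrics with the model. -/

section Estimates

variable {m : ℕ} {ξ a : ℝ}

/-- The normalized factor equals `e^{2t} - 2e^{-2a} + e^{-4a} e^{-2t}`. The prefactor `4e^{-2a}` is
the square of the scale `2e^{-a}` of the charts built later. -/
theorem c2BoundedOn_normalized_sinh_sq (ha : 0 ≤ a) (hξ : 1 < ξ) :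
    C2BoundedOn (modelSet m (ξ - 1)) (fun z => 4 * Real.exp (-(2 * a)) * Real.sinh (z.2 + a) ^ 2)
      (10 * Real.exp (2 * ξ)) ∧
    C2BoundedOn (modelSet m (ξ - 1)) (fun z => 4 * Real.exp (-(2 * a)) * Real.sinh (z.2 + a) ^ 2
      - Real.exp (2 * z.2)) (6 * Real.exp (2 * ξ) * Real.exp (-a)) := by
  have h1 : ∀ t, 4 * Real.exp (-(2 * a)) * Real.sinh (t + a) ^ 2 = 1 * Real.exp (2 * t) +
      -(2 * Real.exp (-(2 * a))) + Real.exp (-(4 * a)) * Real.exp (-(2 * t)) := fun t => by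
    have h2 := sinh_sq_eq a t
    have h3 : Real.exp (-(2 * a)) * Real.exp (2 * a) = 1 := by rw [← Real.exp_add]; simp
    have h4 : Real.exp (-(4 * a)) = Real.exp (-(2 * a)) * Real.exp (-(2 * a)) := by
      rw [← Real.exp_add]; ring_nf
    rw [h4]
    linear_combination Real.exp (-(2 * a)) * h2 + Real.exp (2 * t) * h3
  have hX : 1 ≤ Real.exp (2 * ξ) := Real.one_le_exp (by linarith)
  have ha1 : Real.exp (-a) ≤ 1 := Real.exp_le_one_iff.2 (by linarith)
  have ha2 : Real.exp (-(2 * a)) ≤ Real.exp (-a) := Real.exp_le_exp.2 (by linarith)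
  have ha4 : Real.exp (-(4 * a)) ≤ Real.exp (-a) := Real.exp_le_exp.2 (by linarith)
  have hpos := Real.exp_pos (-a)
  have hU := isOpen_modelSet m (ξ - 1)
  constructor
  · refine ((c2BoundedOn_exp_combination m (ξ - 1) 1 (-(2 * Real.exp (-(2 * a))))
      (Real.exp (-(4 * a)))).mono ?_).congr hU fun z _ => h1 z.2
    rw [abs_neg, abs_one, abs_of_pos (Real.exp_pos _), abs_of_pos (by positivity),
      show 2 * (1 + (ξ - 1)) = 2 * ξ by ring]
    nlinarith
  · refine ((c2BoundedOn_exp_combination m (ξ - 1) 0 (-(2 * Real.exp (-(2 * a))))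
      (Real.exp (-(4 * a)))).mono ?_).congr hU fun z _ => ?_
    · rw [abs_neg, abs_zero, abs_of_pos (Real.exp_pos _), abs_of_pos (by positivity),
        show 2 * (1 + (ξ - 1)) = 2 * ξ by ring]
      nlinarith
    · rw [h1]; ring

theorem norm_le_of_mem_modelSet (hξ : 1 < ξ) {z : ModelSpace m} (hz : z ∈ modelSet m (ξ - 1)) :
    ‖z‖ ≤ ξ := by
  rw [Prod.norm_def]
  refine max_le ?_ ?_
  · have : ‖z.1‖ < 1 := by simpa using hz.1
    linarith
  · rw [Real.norm_eq_abs, abs_le]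
    constructor <;> linarith [hz.2.1, hz.2.2]

variable {V : Set (ModelSpace m)} {N : ModelSpace m → Matrix (Fin m) (Fin m) ℝ} {K β κ : ℝ}

theorem norm_apply_modelBasis_le {T : Euc m →L[ℝ] Euc m} (hT : ‖T‖ ≤ β) (i : Fin m ⊕ Unit) :
    ‖T (modelBasis m i).1‖ ≤ β := by
  have h1 : ‖(modelBasis m i).1‖ ≤ 1 := by
    rcases i with i | i <;> simp [modelBasis]
  have h2 := T.le_of_opNorm_le hT (modelBasis m i).1
  have h3 : 0 ≤ β := (norm_nonneg _).trans hT
  nlinarith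

/-- A slowly varying metric, normalized at the center, is close to the model. -/
theorem c2BoundedOn_warped_sub_model (hξ : 1 < ξ) (ha : 0 ≤ a) (hV : IsOpen V) (hK : 0 ≤ K)
    (hN : ∀ p q, C2BoundedOn V (fun z => N z p q) K) {T : Euc m →L[ℝ] Euc m} (hT : ‖T‖ ≤ β)
    (b : ModelSpace m) (hinner : ∀ v w, coordForm (N b) (T v) (T w) = inner ℝ v w)
    {Λ : ModelSpace m →L[ℝ] ModelSpace m} (hΛ : ‖Λ‖ ≤ κ) (hκ : κ ≤ 1)
    (hmaps : ∀ z ∈ modelSet m (ξ - 1), b + Λ z ∈ V) (i j : Fin m ⊕ Unit) :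
    C2BoundedOn (modelSet m (ξ - 1)) (fun z => 4 * Real.exp (-(2 * a)) * Real.sinh (z.2 + a) ^ 2 *
        coordForm (N (b + Λ z)) (T (modelBasis m i).1) (T (modelBasis m j).1)
        - Real.exp (2 * z.2) * inner ℝ (modelBasis m i).1 (modelBasis m j).1)
      (4 * (10 * Real.exp (2 * ξ)) * (m ^ 2 * β ^ 2 * K * κ * ξ) +
        6 * Real.exp (2 * ξ) * Real.exp (-a)) := by
  have hU := isOpen_modelSet m (ξ - 1)
  obtain ⟨h1, h2⟩ := c2BoundedOn_normalized_sinh_sq (m := m) ha hξ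
  have h3 := (C2BoundedOn.coordForm hV hK hN (norm_apply_modelBasis_le hT i)
    (norm_apply_modelBasis_le hT j)).comp_affine_sub_const hV Λ hΛ hκ hξ.le b hU
    (convex_modelSet m (ξ - 1)) (zero_mem_modelSet m (by linarith))
    (fun z hz => norm_le_of_mem_modelSet hξ hz) hmaps
  rw [hinner] at h3
  have h4 := h2.const_mul hU (inner ℝ (modelBasis m i).1 (modelBasis m j).1)
  refine (((h1.mul hU h3).add hU h4).mono ?_).congr hU fun z _ => by ring
  have := mul_le_mul_of_nonneg_right (abs_inner_modelBasis_le i j)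
    (by positivity : 0 ≤ 6 * Real.exp (2 * ξ) * Real.exp (-a))
  linarith

/-- A crude bound that needs no normalization. -/
theorem c2BoundedOn_warped_sub_model_crude (hξ : 1 < ξ) (ha : 0 ≤ a) (hV : IsOpen V) (hK : 0 ≤ K)
    (hN : ∀ p q, C2BoundedOn V (fun z => N z p q) K) {T : Euc m →L[ℝ] Euc m} (hT : ‖T‖ ≤ 1)
    (b : ModelSpace m) {Q : ℝ} (hQ : Real.exp a ≤ Q)
    {Λ : ModelSpace m →L[ℝ] ModelSpace m} (hΛ : ‖Λ‖ ≤ 1)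
    (hmaps : ∀ z ∈ modelSet m (ξ - 1), b + Λ z ∈ V) (i j : Fin m ⊕ Unit) :
    C2BoundedOn (modelSet m (ξ - 1)) (fun z => Real.sinh (z.2 + a) ^ 2 *
        coordForm (N (b + Λ z)) (T (modelBasis m i).1) (T (modelBasis m j).1)
        - Real.exp (2 * z.2) * inner ℝ (modelBasis m i).1 (modelBasis m j).1)
      (4 * (Q ^ 2 * (10 * Real.exp (2 * ξ))) * (m ^ 2 * K) + 4 * Real.exp (2 * ξ)) := by
  have hU := isOpen_modelSet m (ξ - 1)
  have h1 := (c2BoundedOn_normalized_sinh_sq (m := m) ha hξ).1.const_mul hU (Real.exp (2 * a) / 4)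
  have h3 := (C2BoundedOn.coordForm hV hK hN (norm_apply_modelBasis_le hT i)
    (norm_apply_modelBasis_le hT j)).comp_affine hV Λ hΛ b hmaps
  have h4 := (c2BoundedOn_exp_snd m (ξ - 1)).const_mul hU
    (inner ℝ (modelBasis m i).1 (modelBasis m j).1)
  have hexp : Real.exp (2 * a) * Real.exp (-(2 * a)) = 1 := by rw [← Real.exp_add]; simp
  refine (((h1.mul hU h3).sub hU h4).mono ?_).congr hU fun z _ => ?_
  · have h5 := mul_le_mul_of_nonneg_right (abs_inner_modelBasis_le i j)
      (by positivity : 0 ≤ 4 * Real.exp (2 * ξ))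
    have h6 : |Real.exp (2 * a) / 4| ≤ Q ^ 2 := by
      rw [abs_of_pos (by positivity)]
      have h7 : Real.exp (2 * a) = Real.exp a ^ 2 := by rw [← Real.exp_nat_mul]; norm_num
      have h8 : Real.exp a ^ 2 ≤ Q ^ 2 := by gcongr
      have := sq_nonneg Q
      linarith
    have h7 : 4 * (|Real.exp (2 * a) / 4| * (10 * Real.exp (2 * ξ))) * (m ^ 2 * 1 ^ 2 * K) ≤
        4 * (Q ^ 2 * (10 * Real.exp (2 * ξ))) * (m ^ 2 * 1 ^ 2 * K) := by gcongr
    rw [show 2 * (1 + (ξ - 1)) = 2 * ξ by ring]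
    linarith
  · linear_combination (-Real.sinh (z.2 + a) ^ 2 * coordForm (N (b + Λ z))
      (T (modelBasis m i).1) (T (modelBasis m j).1)) * hexp

theorem norm_prodMap_le {L : Euc m →L[ℝ] Euc m} {l s : ℝ} (hL : ‖L‖ ≤ l) (hs : 0 ≤ s) :
    ‖L.prodMap (s • ContinuousLinearMap.id ℝ ℝ)‖ ≤ l + s := by
  have hl : 0 ≤ l := (norm_nonneg _).trans hL
  refine ContinuousLinearMap.opNorm_le_bound _ (by positivity) fun z => ?_
  change ‖((L z.1, s • z.2) : ModelSpace m)‖ ≤ _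
  rw [Prod.norm_def]
  have h1 := norm_fst_le z
  have h2 := norm_snd_le z
  have h3 := norm_nonneg z
  refine max_le ?_ ?_
  · calc ‖L z.1‖ ≤ l * ‖z.1‖ := L.le_of_opNorm_le hL _
      _ ≤ (l + s) * ‖z‖ := by gcongr; linarith
  · simp only [norm_smul, Real.norm_eq_abs s, abs_of_nonneg hs]
    gcongr; linarith

end Estimates

namespace SphereAtlas

variable {m : ℕ} (𝒜 : SphereAtlas m)

theorem matrix_round_symm (k : Fin 𝒜.card) (x : Euc m) (p q : Fin m) :
    𝒜.matrix (roundMetric (m + 1)) k x p q = 𝒜.matrix (roundMetric (m + 1)) k x q p := by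
  simp only [SphereAtlas.matrix, Matrix.of_apply, roundMetric]
  exact real_inner_comm _ _

theorem matrix_sphericalCut_symm {G : Euc (m + 1) → Euc (m + 1) →L[ℝ] Euc (m + 1) →L[ℝ] ℝ}
    (hG : IsRadialForm G) (r₀ : ℝ) (k : Fin 𝒜.card) (x : Euc m) (p q : Fin m) :
    𝒜.matrix (sphericalCut (fun y v w => G y v w) r₀) k x p q =
      𝒜.matrix (sphericalCut (fun y v w => G y v w) r₀) k x q p :=
  congrArg _ (hG.symm _ _ _)

/-- Interpolations between the round metric and a `c`-bounded metric are uniformly positive. -/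
theorem exists_interpMatrix_lower_bound {ρ : ℝ → ℝ} (h01 : ∀ t, ρ t ∈ Set.Icc (0 : ℝ) 1)
    {c : ℝ} (hc : 0 < c) :
    ∃ lam > 0, ∀ G : Euc (m + 1) → Euc (m + 1) →L[ℝ] Euc (m + 1) →L[ℝ] ℝ, IsRadialForm G →
      ∀ r₀ : ℝ, CBounded 𝒜 c (sphericalCut (fun y v w => G y v w) r₀) →
      ∀ k (z : ModelSpace m), z.1 ∈ 𝒜.U k → ∀ v, lam * ‖v‖ ^ 2 ≤
        coordForm (𝒜.interpMatrix ρ (sphericalCut (fun y v w => G y v w) r₀) k z) v v := by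
  obtain ⟨K, κ, hκ, hS⟩ := 𝒜.exists_round_bounds
  -- One choice of entry and determinant bounds covers both endpoints. The determinant may shrink
  -- along the segment, but a lower bound on the form is preserved by convex combinations.
  obtain ⟨lam, hlam, H⟩ := exists_coordForm_lower_bound m (max K c)
    (lt_min hκ (one_div_pos.2 hc))
  refine ⟨lam, hlam, fun G hG r₀ hb k z hz v => ?_⟩
  have h1 := H _ (𝒜.matrix_round_symm k z.1)
    (fun v => by rw [𝒜.coordForm_matrix_round]; exact real_inner_self_nonneg)
    (fun p q => (((hS k).1 p q).abs_le hz).trans (le_max_left _ _))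
    ((min_le_left _ _).trans ((hS k).2 _ hz)) v
  have h2 := H _ (𝒜.matrix_sphericalCut_symm hG r₀ k z.1)
    (fun v => by
      rw [𝒜.coordForm_matrix_sphericalCut]
      exact mul_nonneg (by positivity) (hG.nonneg _ _))
    (fun p q => ((C2BoundedOn.of_c2Norm_lt (contDiffOn_infty.1
      ((𝒜.contDiffOn_matrix_sphericalCut hG r₀ k p q).mono (𝒜.U_subset_W k)) 2)
      ((hb k).1 p q)).abs_le hz).trans (le_max_right _ _))
    ((min_le_right _ _).trans ((hb k).2 _ hz).le) v
  obtain ⟨h3, h4⟩ := h01 z.2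
  rw [interpMatrix, coordForm_add_smul]
  nlinarith [mul_le_mul_of_nonneg_left h1 (sub_nonneg.2 h4), mul_le_mul_of_nonneg_left h2 h3]

end SphereAtlas

theorem modelMetric_eq {m : ℕ} (z v w : ModelSpace m) :
    modelMetric m z v w = Real.exp (2 * z.2) * inner ℝ v.1 w.1 + v.2 * w.2 := rfl

/-! ### Construction of the charts in the interpolation region. -/

/-- Charts for the forced metric inside the ball of radius `r₀`. -/
theorem exists_chart_hypForce {m : ℕ} (𝒜 : SphereAtlas m) {ρT : ℝ → ℝ} (hρT : IsWarpTrickCutoff ρT)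
    {ξ c : ℝ} (hξ : 1 < ξ) (hc : 1 < c) :
    ∃ C, 0 ≤ C ∧ ∀ G : Euc (m + 1) → Euc (m + 1) →L[ℝ] Euc (m + 1) →L[ℝ] ℝ, IsRadialForm G →
      ∀ ρW : ℝ → ℝ, (∀ t ≤ 0, ρW t = 0) → ∀ r₀ d : ℝ, 4 * (1 + ξ) ≤ d → 2 * ξ ≤ r₀ - d →
      CBounded 𝒜 c (sphericalCut (fun y v w => G y v w) r₀) →
      ∀ p : Euc (m + 1), r₀ - d - ξ ≤ ‖p‖ → ‖p‖ ≤ r₀ - ξ →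
      ∃ φ : ModelSpace m → Euc (m + 1), IsRadialChart (ξ - 1) φ ∧ φ (0, 0) = p ∧ ∀ i j,
        C2BoundedOn (modelSet m (ξ - 1))
          (fun z => pullbackModel φ (hypForce ρT ρW r₀ d fun y v w => G y v w) z
            (modelBasis m i) (modelBasis m j) - modelMetric m z (modelBasis m i) (modelBasis m j))
          (C * (1 / d + Real.exp (-(r₀ - d)))) := by
  obtain ⟨s', hs', hLeb⟩ := 𝒜.exists_ball_subset
  -- `s ≤ 1/2` together with `2/d ≤ 1/2` keeps the linear part of the affine map of norm at most 1.
  obtain ⟨s, hs, hs2, hss⟩ : ∃ s : ℝ, 0 < s ∧ s ≤ 1 / 2 ∧ s ≤ s' :=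
    ⟨min s' (1 / 2), lt_min hs' (by norm_num), min_le_right _ _, min_le_left _ _⟩
  obtain ⟨lam, hlam, hlow⟩ := 𝒜.exists_interpMatrix_lower_bound hρT.mem_Icc (by linarith : 0 < c)
  obtain ⟨K₀, _, _, hround⟩ := 𝒜.exists_round_bounds
  obtain ⟨B, hB, hρB⟩ := exists_deriv_bound_of_plateaus hρT.smooth hρT.eq_zero hρT.eq_one
  obtain ⟨K, hK, hK₀⟩ : ∃ K, 0 ≤ K ∧ 4 * B * K₀ + 4 * B * c ≤ K :=
    ⟨_, le_max_left _ _, le_max_right _ _⟩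
  set β := (Real.sqrt lam)⁻¹
  have hβ : 0 < β := inv_pos.2 (Real.sqrt_pos.2 hlam)
  set Q := 2 * β / s with hQdef
  have hQ : 0 < Q := by positivity
  set X := Real.exp (2 * ξ)
  have hX : 0 < X := Real.exp_pos _
  have hEξ := Real.exp_pos ξ
  -- The first summand serves the normalized charts, the second the crude case; `e^ξ` pays for
  -- `e^{-a} ≤ e^ξ e^{-(r₀-d)}`.
  refine ⟨(40 * X * (m ^ 2 * β ^ 2 * K * ξ) * (2 * β + 2) + 6 * X) * Real.exp ξ +
    (4 * (Q ^ 2 * (10 * X)) * (m ^ 2 * K) + 4 * X) * (Q * Real.exp ξ), by positivity,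
    fun G hG ρW hρW r₀ d hd hrd hb p hp1 hp2 => ?_⟩
  set a := ‖p‖ with hadef
  have ha : ξ ≤ a := by linarith
  have hp0 : a ≠ 0 := by linarith
  obtain ⟨k, x₀, hx₀, hball'⟩ := hLeb (a⁻¹ • p) (by
    rw [norm_smul, norm_inv, Real.norm_eq_abs, abs_of_pos (by linarith), ← hadef,
      inv_mul_cancel₀ hp0])
  have hball := (Metric.ball_subset_ball hss).trans hball'
  have hx₀U : x₀ ∈ 𝒜.U k := hball (Metric.mem_ball_self hs)
  set N := 𝒜.interpMatrix ρT (sphericalCut (fun y v w => G y v w) r₀) k with hN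
  have hV : IsOpen (𝒜.U k ×ˢ (Set.univ : Set ℝ)) := (𝒜.isOpen_U k).prod isOpen_univ
  have hNK : ∀ p q, C2BoundedOn (𝒜.U k ×ˢ (Set.univ : Set ℝ)) (fun z => N z p q) K := fun p q =>
    (𝒜.c2BoundedOn_interpMatrix hB hρT.smooth hρT.mem_Icc hρB (hround k).1
      (fun p q => .of_c2Norm_lt (contDiffOn_infty.1
        ((𝒜.contDiffOn_matrix_sphericalCut hG r₀ k p q).mono (𝒜.U_subset_W k)) 2)
        ((hb k).1 p q)) p q).mono hK₀
  set b : ModelSpace m := (x₀, 2 * ((a - (r₀ - d)) / d)) with hbdef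
  have hmaps : ∀ L : Euc m →L[ℝ] Euc m, ‖L‖ ≤ s → ∀ z ∈ modelSet m (ξ - 1),
      b + (L.prodMap ((2 / d) • ContinuousLinearMap.id ℝ ℝ)) z ∈ 𝒜.U k ×ˢ (Set.univ : Set ℝ) :=
    fun L hL z hz => ⟨𝒜.add_apply_mem hball hL hs hz.1, trivial⟩
  have hd4 : 2 / d ≤ 1 / 2 := by
    rw [div_le_iff₀ (by linarith)]; linarith
  have hd0 : 0 ≤ 2 / d := div_nonneg (by norm_num) (by linarith)
  have hcenter : ∀ L : Euc m →L[ℝ] Euc m,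
      (((0 : Euc m), (0 : ℝ)).2 + a) • 𝒜.param k (x₀ + L ((0 : Euc m), (0 : ℝ)).1) = p := fun L => by
    simp only [map_zero, add_zero, zero_add, hx₀, smul_smul, mul_inv_cancel₀ hp0, one_smul]
  have hE := Real.exp_pos (-(r₀ - d))
  have hdinv : 0 ≤ 1 / d := div_nonneg zero_le_one (by linarith)
  have hEa : Real.exp (-a) ≤ Real.exp ξ * Real.exp (-(r₀ - d)) := by
    rw [← Real.exp_add]
    exact Real.exp_le_exp.2 (by linarith)
  -- The normalized chart has spherical size at most `2e^{-a}β`, and this decides whether it is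
  -- guaranteed to fit in the ball of radius `s`.
  rcases le_or_gt (2 * Real.exp (-a) * β) s with hsmall | hlarge
  · obtain ⟨T, hT, hTinner⟩ := exists_orthonormalizing_map (h := N b) (fun p q => by
        simp only [hN, SphereAtlas.interpMatrix, Matrix.add_apply, Matrix.smul_apply,
          𝒜.matrix_round_symm k _ p q, 𝒜.matrix_sphericalCut_symm hG r₀ k _ p q])
      hlam (hlow G hG r₀ hb k b hx₀U)
    set L := (2 * Real.exp (-a)) • T with hLdef
    have hL' : ‖L‖ ≤ 2 * Real.exp (-a) * β := by
      rw [hLdef, norm_smul, Real.norm_eq_abs, abs_of_pos (by positivity)]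
      gcongr
    have hL := hL'.trans hsmall
    have hTi : Function.Injective T := by
      rw [injective_iff_map_eq_zero]
      intro v hv
      have h1 := hTinner v v
      rw [hv] at h1
      simp only [coordForm, PiLp.zero_apply, zero_mul, Finset.sum_const_zero] at h1
      exact inner_self_eq_zero.1 h1.symm
    have hLi : Function.Injective L := fun v w hvw =>
      hTi (smul_right_injective _ (by positivity : (2 * Real.exp (-a)) ≠ 0) hvw)
    refine ⟨_, 𝒜.isRadialChart_affine hball hL hs hLi (by linarith : 1 + (ξ - 1) ≤ a), hcenter L,
      fun i j => ?_⟩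
    have hmain := c2BoundedOn_warped_sub_model hξ (by linarith : 0 ≤ a) hV hK hNK hT b hTinner
      (norm_prodMap_le hL' hd0) (by linarith) (hmaps L hL) i j
    refine (hmain.mono ?_).congr (isOpen_modelSet _ _) fun z hz => ?_
    · have h1 : 2 * Real.exp (-a) * β + 2 / d ≤
          (2 * β + 2) * Real.exp ξ * (1 / d + Real.exp (-(r₀ - d))) := by
        have h2 : 1 ≤ Real.exp ξ := Real.one_le_exp (by linarith)
        have h3 : 2 / d ≤ 2 * Real.exp ξ * (1 / d) := by
          rw [show 2 / d = 2 * 1 * (1 / d) by ring]; gcongr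
        have h4 : 2 * Real.exp (-a) * β ≤ 2 * (Real.exp ξ * Real.exp (-(r₀ - d))) * β := by gcongr
        have h5 : 0 ≤ 2 * β * Real.exp ξ * (1 / d) := by positivity
        have h6 : 0 ≤ 2 * Real.exp ξ * Real.exp (-(r₀ - d)) := by positivity
        linarith
      have h2 : 4 * (10 * X) * (m ^ 2 * β ^ 2 * K * (2 * Real.exp (-a) * β + 2 / d) * ξ) ≤
          4 * (10 * X) * (m ^ 2 * β ^ 2 * K *
            ((2 * β + 2) * Real.exp ξ * (1 / d + Real.exp (-(r₀ - d)))) * ξ) := by gcongr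
      have h3 : 6 * X * Real.exp (-a) ≤
          6 * X * (Real.exp ξ * (1 / d + Real.exp (-(r₀ - d)))) := by
        gcongr
        refine hEa.trans ?_
        gcongr
        linarith
      have h4 : 0 ≤ (4 * (Q ^ 2 * (10 * X)) * (m ^ 2 * K) + 4 * X) * (Q * Real.exp ξ) *
          (1 / d + Real.exp (-(r₀ - d))) := by positivity
      linarith
    · rw [𝒜.pullback_hypForce_affine hG ρT hρW d hball hL hs (by linarith) (by linarith) hz,
        modelMetric_eq, hLdef]
      have h7 : Real.exp (-(2 * a)) = Real.exp (-a) ^ 2 := by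
        rw [← Real.exp_nat_mul]; congr 1; push_cast; ring
      simp only [smul_apply, coordForm_smul_smul, h7]
      ring
  -- Now `e^a < 2β/s = Q`, hence `1 ≤ Q e^ξ (1/d + e^{-(r₀-d)})`. Any chart with bounded error will
  -- do, so no normalization is attempted.
  · set L := s • ContinuousLinearMap.id ℝ (Euc m) with hLdef
    have hL : ‖L‖ ≤ s := by
      rw [hLdef, norm_smul, Real.norm_eq_abs, abs_of_pos hs]
      exact mul_le_of_le_one_right hs.le ContinuousLinearMap.norm_id_le
    have hLi : Function.Injective L := fun v w hvw => smul_right_injective _ hs.ne' hvw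
    have hQa : Real.exp a ≤ Q := by
      rw [hQdef, le_div_iff₀ hs]
      have h1 : Real.exp a * Real.exp (-a) = 1 := by rw [← Real.exp_add]; simp
      have h2 := mul_le_mul_of_nonneg_left hlarge.le (Real.exp_pos a).le
      calc Real.exp a * s ≤ Real.exp a * (2 * Real.exp (-a) * β) := h2
        _ = 2 * β * (Real.exp a * Real.exp (-a)) := by ring
        _ = 2 * β := by rw [h1, mul_one]
    refine ⟨_, 𝒜.isRadialChart_affine hball hL hs hLi (by linarith : 1 + (ξ - 1) ≤ a), hcenter L,
      fun i j => ?_⟩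
    have hmain := c2BoundedOn_warped_sub_model_crude hξ (by linarith : 0 ≤ a) hV hK hNK
      (T := L) (hL.trans (by linarith)) b hQa ((norm_prodMap_le hL hd0).trans (by linarith))
      (hmaps L hL) i j
    refine (hmain.mono ?_).congr (isOpen_modelSet _ _) fun z hz => ?_
    · have h1 : 1 ≤ Q * Real.exp ξ * (1 / d + Real.exp (-(r₀ - d))) := by
        have h2 : Real.exp a * Real.exp (-a) = 1 := by rw [← Real.exp_add]; simp
        calc 1 = Real.exp a * Real.exp (-a) := h2.symm
          _ ≤ Q * (Real.exp ξ * (1 / d + Real.exp (-(r₀ - d)))) := by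
            gcongr
            refine hEa.trans ?_
            gcongr
            linarith
          _ = _ := by ring
      have h2 : 0 ≤ 4 * (Q ^ 2 * (10 * X)) * (m ^ 2 * K) + 4 * X := by positivity
      have h3 := mul_le_mul_of_nonneg_left h1 h2
      have h4 : 0 ≤ (40 * X * (m ^ 2 * β ^ 2 * K * ξ) * (2 * β + 2) + 6 * X) * Real.exp ξ *
          (1 / d + Real.exp (-(r₀ - d))) := by positivity
      linarith
    · rw [𝒜.pullback_hypForce_affine hG ρT hρW d hball hL hs (by linarith) (by linarith) hz,
        modelMetric_eq]
      ring

/-! ### Assembly of the two regions and the explicit constant. -/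

/-- Since `ξ > 1`, the gap `e^{16+2ξ}` is at least `e^{18} ≥ 2.7^18`, which exceeds `548·10⁴`. -/
theorem constant_le_exp {ξ : ℝ} (hξ : 1 < ξ) :
    548 * 10 ^ 4 * Real.exp (4 * ξ) ≤ Real.exp (16 + 6 * ξ) := by
  have h1 : Real.exp (16 + 6 * ξ) = Real.exp (16 + 2 * ξ) * Real.exp (4 * ξ) := by
    rw [← Real.exp_add]; ring_nf
  rw [h1]
  gcongr
  have h2 : Real.exp 18 ≤ Real.exp (16 + 2 * ξ) := Real.exp_le_exp.2 (by linarith)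
  have h3 : Real.exp 18 = Real.exp 1 ^ 18 := by rw [← Real.exp_nat_mul]; norm_num
  have h4 : (2.7 : ℝ) ≤ Real.exp 1 := by linarith [Real.exp_one_gt_d9]
  have h5 : (2.7 : ℝ) ^ 18 ≤ Real.exp 1 ^ 18 := by gcongr
  have h6 : (548 * 10 ^ 4 : ℝ) ≤ 2.7 ^ 18 := by norm_num
  linarith

theorem hypForce_closeToHyperbolic {m : ℕ} (𝒜 : SphereAtlas m) {ρT ρW : ℝ → ℝ}
    (hρT : IsWarpTrickCutoff ρT) (hρW : IsWarpForcingCutoff ρW) {B : ℝ} (hB : 1 ≤ B)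
    (hρB : ∀ t, |deriv ρW t| ≤ B ∧ |deriv (deriv ρW) t| ≤ B)
    {ξ c C₂ : ℝ} (hξ : 1 < ξ) (hc : 1 < c) (hC₂ : 548 * B * Real.exp (4 * ξ) ≤ C₂) :
    ∃ C₁, ∀ G : Euc (m + 1) → Euc (m + 1) →L[ℝ] Euc (m + 1) →L[ℝ] ℝ, IsRadialForm G →
      ∀ r₀ d ε η : ℝ, 4 * (1 + ξ) ≤ d → 2 * ξ ≤ r₀ - d →
      CBounded 𝒜 c (sphericalCut (fun y v w => G y v w) r₀) →
      RadiallyClose (fun y v w => G y v w) ε ξ (Metric.ball 0 (r₀ - (1 + ξ)))ᶜ →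
      C₁ * (1 / d + Real.exp (-(r₀ - d))) + C₂ * ε ≤ η →
      BallCloseToHyperbolic (hypForce ρT ρW r₀ d fun y v w => G y v w) (r₀ - d) η (ξ - 1) := by
  obtain ⟨C, hC, H⟩ := exists_chart_hypForce 𝒜 hρT hξ hc
  -- The extra 1 gives the strict inequality required by closeness to the model.
  refine ⟨C + 112 * B * Real.exp (2 * ξ) + 1, fun G hG r₀ d ε η hd hrd hb hclose hη => ?_⟩
  have hE := Real.exp_pos (-(r₀ - d))
  have hd0 : 0 < d := by linarith
  have hdinv : 0 < 1 / d := one_div_pos.2 hd0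
  have hC₂0 : 0 ≤ C₂ := le_trans (by positivity) hC₂
  -- No sign of `ε` is assumed; a chart at a sufficiently distant point forces it, as no norm is
  -- below `ENNReal.ofReal ε` otherwise.
  have hε : 0 ≤ ε := by
    obtain ⟨p, hp⟩ := NormedSpace.exists_lt_norm ℝ (Euc (m + 1)) (r₀ - (1 + ξ))
    obtain ⟨φ, -, -, h⟩ := hclose p (by simpa using hp.le)
    exact (ENNReal.ofReal_pos.1 (bot_lt_of_lt (h (Sum.inr ()) (Sum.inr ())))).le
  have hX := Real.exp_pos (2 * ξ)
  have hBX : 0 ≤ 112 * B * Real.exp (2 * ξ) := by positivity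
  set σ := 1 / d + Real.exp (-(r₀ - d)) with hσ
  have hσ0 : 0 < σ := by positivity
  have hC₂ε : 0 ≤ C₂ * ε := mul_nonneg hC₂0 hε
  have hη0 : 0 < η := lt_of_lt_of_le (by positivity) hη
  refine ⟨fun y _ hy v w => ?_, fun p hp => ?_⟩
  · have h0 : ρT (2 * ((‖y‖ - (r₀ - d)) / d)) = 0 := hρT.eq_zero _ (by
      have := div_nonpos_of_nonpos_of_nonneg (by linarith : ‖y‖ - (r₀ - d) ≤ 0) hd0.le
      linarith)
    simp [hypForce, warpTrick, h0]
  · have hp' : r₀ - d - ξ ≤ ‖p‖ := by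
      have h1 : r₀ - d - 1 - (ξ - 1) ≤ ‖p‖ := by simpa using hp
      linarith
    -- For `‖p‖ ≤ r₀ - ξ` a chart of excess `ξ - 1` stays inside radius `r₀`, where `ρW` vanishes.
    -- Beyond, the original hypothesis supplies a chart.
    rcases le_or_gt ‖p‖ (r₀ - ξ) with hin | hout
    · have h0 : ∀ t ≤ 0, ρW t = 0 := fun t ht => by
        obtain ⟨δ, hδ, h0, -⟩ := hρW.plateaus
        exact h0 t (by linarith)
      obtain ⟨φ, hφ, hφp, hφb⟩ := H G hG ρW h0 r₀ d hd hrd hb p hp' hin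
      refine ⟨φ, hφ, hφp, fun i j => (hφb i j).c2Norm_lt ?_ hη0⟩
      nlinarith
    · obtain ⟨φ, hφ, hφp, hφc⟩ := hclose p (by
        have : r₀ - (1 + ξ) ≤ ‖p‖ := by linarith
        simpa using this)
      obtain ⟨φ₁, a, hpol⟩ := hφ.exists_isPolarMap (by linarith)
      have ha : ‖p‖ = a := by
        have h1 := hpol.norm_map (zero_mem_modelSet m (by linarith))
        rw [← hφp]
        exact h1.trans (zero_add a)
      refine ⟨φ, hφ.mono (by linarith), hφp, fun i j =>
        (c2BoundedOn_hypForce_of_epsClose hG hρT.eq_one hB hρW hρB hξ hd hrd hpol (by linarith)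
          hφc i j).c2Norm_lt ?_ hη0⟩
      have h1 := mul_le_mul_of_nonneg_right hC₂ hε
      have h2 : 112 * B * Real.exp (2 * ξ) * Real.exp (-(r₀ - d)) ≤
          112 * B * Real.exp (2 * ξ) * σ := by
        gcongr
        linarith
      have h3 : 0 ≤ C * σ := by positivity
      linarith

theorem theorem1 (ρW : ℝ → ℝ) (hρW : IsWarpForcingCutoff ρW) (ξ : ℝ) (hξ : 1 < ξ) :
    ∃ C₂ : ℝ,
      ((∀ t, |deriv ρW t| ≤ 10 ^ 4 ∧ |deriv (deriv ρW) t| ≤ 10 ^ 4) →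
        C₂ = Real.exp (16 + 6 * ξ)) ∧
      ∀ (ρT : ℝ → ℝ), IsWarpTrickCutoff ρT →
      ∀ (m : ℕ) (𝒜 : SphereAtlas m) (c : ℝ), 1 < c →
      ∃ C₁ : ℝ,
        ∀ (M : Type u) [TopologicalSpace M] [ChartedSpace (Euc (m + 1)) M]
          [IsManifold (𝓡 (m + 1)) ∞ M]
          (g : Bundle.ContMDiffRiemannianMetric (𝓡 (m + 1)) ∞ (Euc (m + 1))
            (fun x : M => TangentSpace (𝓡 (m + 1)) x))
          (o : M) (Φ : Diffeomorph (𝓡 (m + 1)) (𝓡 (m + 1)) (Euc (m + 1)) M ∞),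
          IsExpAtCenter g o Φ →
        ∀ (r₀ d ε η : ℝ), 4 * (1 + ξ) ≤ d → 2 * ξ ≤ r₀ - d →
          CBounded 𝒜 c (sphericalCut (pullbackMetric g Φ) r₀) →
          RadiallyClose (pullbackMetric g Φ) ε ξ (Metric.ball 0 (r₀ - (1 + ξ)))ᶜ →
          C₁ * (1 / d + Real.exp (-(r₀ - d))) + C₂ * ε ≤ η →
          BallCloseToHyperbolic (hypForce ρT ρW r₀ d (pullbackMetric g Φ)) (r₀ - d) η (ξ - 1) := by
  obtain ⟨B, C₂, hB, hρB, hC₂, hspecial⟩ : ∃ B C₂ : ℝ, 1 ≤ B ∧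
      (∀ t, |deriv ρW t| ≤ B ∧ |deriv (deriv ρW) t| ≤ B) ∧ 548 * B * Real.exp (4 * ξ) ≤ C₂ ∧
      ((∀ t, |deriv ρW t| ≤ 10 ^ 4 ∧ |deriv (deriv ρW) t| ≤ 10 ^ 4) →
        C₂ = Real.exp (16 + 6 * ξ)) := by
    -- `C₂` is fixed before `ρT`, the dimension, the atlas and `c`. Splitting here lets the same
    -- existential carry the explicit value when the derivative bounds hold.
    by_cases h : ∀ t, |deriv ρW t| ≤ 10 ^ 4 ∧ |deriv (deriv ρW) t| ≤ 10 ^ 4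
    · exact ⟨10 ^ 4, Real.exp (16 + 6 * ξ), by norm_num, h, constant_le_exp hξ, fun _ => rfl⟩
    · obtain ⟨δ, -, h0, h1⟩ := hρW.plateaus
      obtain ⟨B, hB, hρB⟩ := exists_deriv_bound_of_plateaus hρW.smooth h0 h1
      exact ⟨B, _, hB, hρB, le_rfl, fun h' => absurd h' h⟩
  refine ⟨C₂, hspecial, fun ρT hρT m 𝒜 c hc => ?_⟩
  obtain ⟨C₁, H⟩ := hypForce_closeToHyperbolic 𝒜 hρT hρW hB hρB hξ hc hC₂
  refine ⟨C₁, fun M _ _ _ g o Φ hexp r₀ d ε η hd hrd hb hclose hη => ?_⟩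
  obtain ⟨G, hG, hGeq⟩ := pullbackMetric_isRadialForm g hexp
  rw [hGeq] at hb hclose ⊢
  exact H G hG r₀ d ε η hd hrd hb hclose hη
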